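/- Let $\nabla$ be a smooth connection on a smooth real vector bundle $\pi:W\to M$ of finite rank over a smooth (finite-dimensional, Hausdorff) manifold $M$ without boundary, with curvature tensor $R(u,v)w$. For a subset $V\subseteq W$ with fibres $V_x = V\cap W_x$, a local section of $V$ is a smooth section $X:U\to W$ over an open set $U\subseteq M$ with $X(y)\in V_y$ for all $y\in U$. The smooth part $\mathcal S(V)$ of $V$ is the set of all $X(x)$, where $X$ is a local section of $V$ and $x$ is in its domain. The kernel $\ker\alpha_V$ of the second fundamental 1-form of $V$ is the set of all $w\in V_x$, $x\in M$, for which there is a local section $X$ of $V$, defined near $x$, with $X(x)=w$ and $\nabla_uX(x)\in V_x$ for all $u\in T_xM$ (that is, the class of $\nabla X(x)$ in $T_x^*M\otimes (W_x/V_x)$ vanishes). The derived flag is $$W^{(0)}=\mathcal S\big(\{w\in W: R(\cdot,\cdot)w=0\}\big),\qquad W^{(i+1)}=\mathcal S\big(\ker\alpha_{W^{(i)}}\big)\quad(i\ge 0),$$ and $\widetilde W=\bigcap_i W^{(i)}$ is its limit. A local section $X:U\to W$ is parallel if $\nabla X=0$ on $U$. The connection is regular at $x$ if there is an open neighbourhood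 $U$ of $x$ such that $\widetilde W|_U$ is a smooth vector subbundle of $W|_U$, that is, near each point of $U$ there is a tuple of local sections of $\widetilde W$ that at each point $z$ of their domain form a basis of $\widetilde W_z$. Theorem 1. The derived flag is decreasing and becomes stationary: there is $k$ with $W^{(l)}=\widetilde W$ for all $l\ge k$. Moreover: (i) if $X:U\subseteq M\to W$ is a local parallel section, then $X(y)\in\widetilde W$ for all $y\in U$; (ii) if $\nabla$ is regular at $x$, then for every $w\in\widetilde W_x$ there are an open neighbourhood $U$ of $x$ and a parallel section $X:U\to W$ with values in $\widetilde W$ and $X(x)=w$. -/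

import Mathlib

open Bundle
open scoped Manifold ContDiff

namespace DerivedFlag

noncomputable section

variable {E : Type*} [NormedAddCommGroup E] [NormedSpace ℝ E]
  {M : Type*} [TopologicalSpace M] [ChartedSpace E M] [IsManifold 𝓘(ℝ, E) ∞ M]
  {F : Type*} [NormedAddCommGroup F] [NormedSpace ℝ F]
  {W : M → Type*} [TopologicalSpace (TotalSpace F W)]
  [∀ x, AddCommGroup (W x)] [∀ x, Module ℝ (W x)]
  [∀ x, TopologicalSpace (W x)]
  [∀ x, IsTopologicalAddGroup (W x)] [∀ x, ContinuousSMul ℝ (W x)]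
  [FiberBundle F W]

/- Conventions. A subset `V` of the total space of the bundle is given by its fibres
`V x : Set (W x)`. A local section over an open set `U` is a section `X : ∀ x, W x` of which only
the restriction to `U` is used. The covariant derivative `(∇_u X)(x)`, for `u` tangent at `x`,
is `cov X x u`. -/

variable (E F) in
/-- `X` restricts to a smooth local section over the open set `U` with values in `V`. -/
def IsSmoothSectionOf (V : ∀ x : M, Set (W x)) (U : Set M) (X : ∀ x, W x) : Prop :=
  IsOpen U ∧
    ContMDiffOn 𝓘(ℝ, E) (𝓘(ℝ, E).prod 𝓘(ℝ, F)) ∞ (fun x ↦ TotalSpace.mk' F x (X x)) U ∧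
    ∀ x ∈ U, X x ∈ V x

/-- The operator `∇_A ∇_B X - ∇_B ∇_A X - ∇_[A, B] X` on vector fields `A`, `B` and sections
`X`. -/
def curvatureOp (cov : CovariantDerivative 𝓘(ℝ, E) F W)
    (A B : ∀ x : M, TangentSpace 𝓘(ℝ, E) x) (X : ∀ x, W x) (x : M) : W x :=
  cov (fun y ↦ cov X y (B y)) x (A x) - cov (fun y ↦ cov X y (A y)) x (B x)
    - cov X x (VectorField.mlieBracket 𝓘(ℝ, E) A B x)

/-- The curvature tensor `R(u, v) w` at `x`: the curvature operator applied to fields that are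
smooth near `x` and take the values `u`, `v`, `w` at `x`. For a smooth connection the value
does not depend on the extensions. -/
def curvature (cov : CovariantDerivative 𝓘(ℝ, E) F W) (x : M)
    (u v : TangentSpace 𝓘(ℝ, E) x) (w : W x) : W x :=
  curvatureOp cov (FiberBundle.extend E u) (FiberBundle.extend E v) (FiberBundle.extend F w) x

/-- The kernel of the curvature: all `w` with `R(u, v) w = 0` for all `u`, `v`. -/
def curvatureKer (cov : CovariantDerivative 𝓘(ℝ, E) F W) (x : M) : Set (W x) :=
  {w | ∀ u v : TangentSpace 𝓘(ℝ, E) x, curvature cov x u v w = 0}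

variable (E F) in
/-- The smooth part of `V`: the elements of `V` through which there is a smooth local section
with values in `V`. -/
def smoothPart (V : ∀ x : M, Set (W x)) (x : M) : Set (W x) :=
  {w | ∃ (U : Set M) (X : ∀ x, W x), x ∈ U ∧ IsSmoothSectionOf E F V U X ∧ X x = w}

/-- The kernel of the second fundamental 1-form of `V`. The form sends `w ∈ V x` to the class of
`∇X (x)` in `Hom(T_x M, W x / V x)`, where `X` is a smooth local section of `V` with
`X x = w`; so `w` is in the kernel if `∇_u X (x) ∈ V x` for all `u` and such an `X`. -/
def secondFundamentalKer (cov : CovariantDerivative 𝓘(ℝ, E) F W) (V : ∀ x : M, Set (W x))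
    (x : M) : Set (W x) :=
  {w | ∃ (U : Set M) (X : ∀ x, W x), x ∈ U ∧ IsSmoothSectionOf E F V U X ∧ X x = w ∧
    ∀ u : TangentSpace 𝓘(ℝ, E) x, cov X x u ∈ V x}

/-- The derived flag. -/
def flag (cov : CovariantDerivative 𝓘(ℝ, E) F W) : ℕ → ∀ x : M, Set (W x)
  | 0 => smoothPart E F (curvatureKer cov)
  | i + 1 => smoothPart E F (secondFundamentalKer cov (flag cov i))

/-- The limit of the (decreasing) derived flag. -/
def flagLimit (cov : CovariantDerivative 𝓘(ℝ, E) F W) (x : M) : Set (W x) :=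
  ⋂ i : ℕ, flag cov i x

variable (E F) in
/-- `V` is a smooth vector bundle over `U`, as a subbundle of the given bundle: every point of `U`
has an open neighbourhood over which `V` has a smooth frame. -/
def IsSubbundleOn (V : ∀ x : M, Set (W x)) (U : Set M) : Prop :=
  ∀ y ∈ U, ∃ U' ⊆ U, IsOpen U' ∧ y ∈ U' ∧ ∃ (n : ℕ) (s : Fin n → ∀ x, W x),
    (∀ j, IsSmoothSectionOf E F V U' (s j)) ∧
    ∀ z ∈ U', LinearIndependent ℝ (fun j ↦ s j z) ∧
      V z = (Submodule.span ℝ (Set.range fun j ↦ s j z) : Set (W z))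

/-- The connection is regular at `x`: the limit of the derived flag is a vector bundle over
a neighbourhood of `x`. -/
def IsRegularAt (cov : CovariantDerivative 𝓘(ℝ, E) F W) (x : M) : Prop :=
  ∃ U : Set M, IsOpen U ∧ x ∈ U ∧ IsSubbundleOn E F (flagLimit cov) U

/-- `X` restricts to a parallel smooth local section over the open set `U`. -/
def IsParallelOn (cov : CovariantDerivative 𝓘(ℝ, E) F W) (U : Set M) (X : ∀ x, W x) : Prop :=
  IsSmoothSectionOf E F (fun _ ↦ Set.univ) U X ∧ ∀ x ∈ U, cov X x = 0

end

end DerivedFlag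

/-!
Stationarity rests on a comparison with a dense open set. All members of the flag have linear
fibres, and their ranks are lower semicontinuous because every vector of a member extends to
a smooth section of it. Hence, with `n` the rank of `W`, the ranks of the members `0, …, n + 1` are
locally constant on a dense open set `O` (`exists_dense_locally_constant`). Near a point of `O` two
consecutive members have the same rank, so they coincide, and so do all later ones; there the
member `n` is a bundle, locally, and the second fundamental form vanishes on it for every choice of
sections (`HasLinearFibres.cov_mem_of_fibreRank_eq`): it is preserved by `∇` over `O`
(`exists_dense_cov_mem_flag`). Now take a smooth section `X` over `U` with values in the member `n`
over `U ∩ O`. Its derivatives along smooth fields have the same property, and by continuity of the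
curvature all these sections lie in the kernel of the curvature over all of `U`. By induction they
lie in every member of the flag (`flag_finrank_subset`), so the flag is stationary from the step
`n` on. No regularity is needed outside `O`.

A parallel section lies in the kernel of the curvature and its derivative is zero, so it is
a section of each member of the flag by induction.

At a regular point the limit `V` of the flag is a bundle near the point. As `V` is equal to the
smooth part of the kernel of its own second fundamental form and has locally constant rank, it is
preserved by `∇`; and it lies in the kernel of the curvature. So `∇` restricts to a flat connection
on `V`, and a flat connection has parallel sections through every vector. In a chart and a frame
this says that `dc = -Γ c` is locally solvable if `dΓ + Γ ∧ Γ = 0`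
(`exists_smooth_solution_of_flat`), which is proved by integrating along rays. The coefficients of
`Γ` are read off with a smooth dual coframe (`exists_dual_coframe`), and the flatness condition is
the vanishing of the curvature on coordinate fields, which commute (`connection_matrix_flat`).
-/

namespace DerivedFlag

open Set Filter Topology

-- the instances on `V →L[ℝ] G →L[ℝ] G` need nested instance problems
set_option maxSynthPendingDepth 3
set_option linter.unusedSectionVars false

/-! ### Solving `dc = -Γ c` for flat `Γ` -/

section FlatPotential

variable {V G : Type*} [NormedAddCommGroup V] [NormedSpace ℝ V] [NormedAddCommGroup G]
  [NormedSpace ℝ G]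

/-- Grönwall's inequality on the unit interval; `2` bounds `exp 1 - 1`. -/
theorem norm_le_of_norm_deriv_le_of_eq_zero {f f' : ℝ → G} {ε : ℝ} (hε : 0 ≤ ε)
    (hf : ∀ t ∈ Icc (0 : ℝ) 1, HasDerivWithinAt f (f' t) (Icc 0 1) t) (h0 : f 0 = 0)
    (hb : ∀ t ∈ Icc (0 : ℝ) 1, ‖f' t‖ ≤ ‖f t‖ + ε) {t : ℝ} (ht : t ∈ Icc (0 : ℝ) 1) :
    ‖f t‖ ≤ 2 * ε := by
  have h := norm_le_gronwallBound_of_norm_deriv_right_le (f := f) (f' := f') (δ := 0) (K := 1)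
    (ε := ε) (fun s hs ↦ (hf s hs).continuousWithinAt)
    (fun s hs ↦ (hf s ⟨hs.1, hs.2.le⟩).mono_of_mem_nhdsWithin
      (Icc_mem_nhdsGE_of_mem hs)) (by simp [h0])
    (fun s hs ↦ by simpa using hb s ⟨hs.1, hs.2.le⟩) t ht
  refine h.trans ?_
  rw [gronwallBound_of_K_ne_0 one_ne_zero]
  have h1 : Real.exp (1 * (t - 0)) ≤ Real.exp 1 := Real.exp_le_exp.2 (by linarith [ht.2])
  have h2 := Real.exp_one_lt_d9
  nlinarith

/-- A linear equation with coefficient of norm at most `1 / 2` is solvable on all of the unit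
interval: the closed ball of radius `‖c₀‖` around `c₀` satisfies the Picard–Lindelöf conditions. -/
theorem exists_linear_ode_solution [CompleteSpace G] {A : ℝ → G →L[ℝ] G}
    (hA : ContinuousOn A (Icc 0 1)) (hA' : ∀ t ∈ Icc (0 : ℝ) 1, ‖A t‖ ≤ 1 / 2) (c₀ : G) :
    ∃ γ : ℝ → G, γ 0 = c₀ ∧
      (∀ t ∈ Icc (0 : ℝ) 1, HasDerivWithinAt γ (A t (γ t)) (Icc 0 1) t) ∧
      ∀ t ∈ Icc (0 : ℝ) 1, ‖γ t‖ ≤ 2 * ‖c₀‖ := by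
  have pl : IsPicardLindelof (fun t x ↦ A t x) (tmin := 0) (tmax := 1)
      ⟨0, left_mem_Icc.2 zero_le_one⟩ c₀ ‖c₀‖₊ 0 ‖c₀‖₊ 1 := by
    constructor
    · intro t ht
      refine LipschitzWith.lipschitzOnWith ((A t).lipschitz.weaken ?_)
      rw [← NNReal.coe_le_coe]
      exact (hA' t ht).trans (by norm_num)
    · intro x _
      exact hA.clm_apply continuousOn_const
    · intro t ht x hx
      have hx' : ‖x‖ ≤ 2 * ‖c₀‖ := by
        have := norm_le_norm_add_norm_sub' x c₀
        have h2 : ‖x - c₀‖ ≤ ‖c₀‖ := by simpa [dist_eq_norm] using hx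
        linarith
      calc ‖A t x‖ ≤ ‖A t‖ * ‖x‖ := (A t).le_opNorm x
        _ ≤ 1 / 2 * (2 * ‖c₀‖) := by gcongr; exact hA' t ht
        _ = ‖c₀‖₊ := by simp
    · simp
  obtain ⟨γ, h0, hγ⟩ := pl.exists_eq_forall_mem_Icc_hasDerivWithinAt₀
  refine ⟨γ, h0, hγ, fun t ht ↦ ?_⟩
  have hd : ∀ s ∈ Icc (0 : ℝ) 1, HasDerivWithinAt (fun s ↦ γ s - c₀) (A s (γ s)) (Icc 0 1) s :=
    fun s hs ↦ (hγ s hs).sub_const c₀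
  have hb := norm_le_of_norm_deriv_le_of_eq_zero (ε := ‖c₀‖ / 2) (by positivity) hd
    (by simpa using sub_eq_zero.2 h0) (fun s hs ↦ by
      have h1 := norm_le_norm_add_norm_sub' (γ s) c₀
      have h2 := ((A s).le_opNorm (γ s)).trans
        (mul_le_mul_of_nonneg_right (hA' s hs) (norm_nonneg _))
      have h3 := norm_nonneg (γ s - c₀)
      linarith) ht
  have h1 := norm_le_norm_add_norm_sub' (γ t) c₀
  linarith

/-- First order Taylor bounds with a uniform constant near a point where `Γ` is `C²`; the
derivative is locally Lipschitz there. -/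
theorem exists_ball_taylor_bounds {H : Type*} [NormedAddCommGroup H] [NormedSpace ℝ H]
    {Γ : V → H} (hΓ : ContDiffAt ℝ 2 Γ 0) :
    ∃ r > 0, ∃ C : ℝ, 0 ≤ C ∧ (∀ p ∈ Metric.ball (0 : V) r, ‖Γ p‖ ≤ C ∧ ‖fderiv ℝ Γ p‖ ≤ C ∧
      HasFDerivAt Γ (fderiv ℝ Γ p) p) ∧
      ∀ p ∈ Metric.ball (0 : V) r, ∀ q ∈ Metric.ball (0 : V) r,
        ‖Γ q - Γ p‖ ≤ C * ‖q - p‖ ∧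
        ‖Γ q - Γ p - fderiv ℝ Γ p (q - p)‖ ≤ C * ‖q - p‖ ^ 2 := by
  have hd : ContDiffAt ℝ 1 (fderiv ℝ Γ) 0 := hΓ.fderiv_right (by norm_num)
  obtain ⟨K, t, ht, hK⟩ := hd.exists_lipschitzOnWith
  have e1 : ∀ᶠ p in 𝓝 (0 : V), ‖Γ p‖ < ‖Γ 0‖ + 1 :=
    hΓ.continuousAt.norm.eventually_lt continuousAt_const (by simp)
  have e2 : ∀ᶠ p in 𝓝 (0 : V), ‖fderiv ℝ Γ p‖ < ‖fderiv ℝ Γ 0‖ + 1 :=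
    hd.continuousAt.norm.eventually_lt continuousAt_const (by simp)
  have e3 : ∀ᶠ p in 𝓝 (0 : V), HasFDerivAt Γ (fderiv ℝ Γ p) p := by
    filter_upwards [hΓ.eventually (by simp)] with p hp
    exact (hp.differentiableAt (by simp)).hasFDerivAt
  obtain ⟨r, hr, hball⟩ := Metric.eventually_nhds_iff_ball.1 (e1.and (e2.and (e3.and ht)))
  have k0 : (0 : ℝ) ≤ K := K.2
  have k1 := norm_nonneg (Γ 0)
  have k2 := norm_nonneg (fderiv ℝ Γ 0)
  refine ⟨r, hr, ‖Γ 0‖ + 1 + (‖fderiv ℝ Γ 0‖ + 1) + K, by positivity, fun p hp ↦ ?_,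
    fun p hp q hq ↦ ⟨?_, ?_⟩⟩
  · obtain ⟨h1, h2, h3, -⟩ := hball p hp
    exact ⟨by linarith, by linarith, h3⟩
  · refine ((convex_ball _ _).norm_image_sub_le_of_norm_hasFDerivWithin_le
      (f := Γ) (f' := fderiv ℝ Γ) (C := ‖fderiv ℝ Γ 0‖ + 1)
      (fun z hz ↦ (hball z hz).2.2.1.hasFDerivWithinAt)
      (fun z hz ↦ (hball z hz).2.1.le) hp hq).trans ?_
    refine mul_le_mul_of_nonneg_right ?_ (norm_nonneg _)
    linarith
  · have hseg : segment ℝ p q ⊆ Metric.ball 0 r := (convex_ball _ _).segment_subset hp hq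
    have := (convex_segment (𝕜 := ℝ) p q).norm_image_sub_le_of_norm_hasFDerivWithin_le'
      (f := Γ) (f' := fderiv ℝ Γ) (φ := fderiv ℝ Γ p) (C := K * ‖q - p‖)
      (fun z hz ↦ (hball z (hseg hz)).2.2.1.hasFDerivWithinAt) (fun z hz ↦ by
        refine (hK.norm_sub_le (hball z (hseg hz)).2.2.2 (hball p hp).2.2.2).trans ?_
        gcongr
        have := segment_subset_closedBall_left p q hz
        simpa [dist_eq_norm, norm_sub_rev] using this)
      (left_mem_segment ℝ p q) (right_mem_segment ℝ p q)
    rw [mul_assoc, ← sq] at this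
    refine this.trans ?_
    gcongr
    linarith

/-- The equation `dc = -Γ c` has local solutions if `Γ` is flat, i.e. `dΓ + Γ ∧ Γ = 0`. The
solution is found by integrating along rays: `c v = γ v 1`, where `γ v` solves the equation along
`t ↦ t • v`. Its derivative is the expected one because, for `w = v + h`, the error
`δ t = γ w t - γ v t + t • Γ (t v) h (γ v t)` satisfies `δ' = -Γ (t v) v δ + O(‖h‖²)`, where
flatness cancels the terms that are linear in `h`. -/
theorem exists_hasFDerivAt_of_flat [CompleteSpace G] {Γ : V → V →L[ℝ] G →L[ℝ] G}
    (hΓ : ContDiffAt ℝ 2 Γ 0)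
    (flat : ∀ᶠ p in 𝓝 0, ∀ a b, fderiv ℝ Γ p a b - fderiv ℝ Γ p b a + (Γ p a).comp (Γ p b)
      - (Γ p b).comp (Γ p a) = 0) (c₀ : G) :
    ∃ r > 0, ∃ c : V → G, c 0 = c₀ ∧
      ∀ p ∈ Metric.ball (0 : V) r, HasFDerivAt c (-((Γ p).flip (c p))) p := by
  obtain ⟨r₀, hr₀, C, hC, hbd, htay⟩ := exists_ball_taylor_bounds hΓ
  obtain ⟨r₁, hr₁, hflat⟩ := Metric.eventually_nhds_iff_ball.1 flat
  obtain ⟨r, hr, hr0, hr1, hr1', hCr⟩ : ∃ r : ℝ, 0 < r ∧ r ≤ r₀ ∧ r ≤ r₁ ∧ r ≤ 1 ∧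
      C * r ≤ 1 / 2 := by
    refine ⟨min (min r₀ r₁) (min 1 (1 / (2 * (C + 1)))), by positivity, ?_, ?_, ?_, ?_⟩
    · exact (min_le_left _ _).trans (min_le_left _ _)
    · exact (min_le_left _ _).trans (min_le_right _ _)
    · exact (min_le_right _ _).trans (min_le_left _ _)
    · calc C * _ ≤ (C + 1) * (1 / (2 * (C + 1))) := by
            gcongr
            · linarith
            · exact (min_le_right _ _).trans (min_le_right _ _)
        _ = 1 / 2 := by field_simp
  have hball : ∀ v ∈ Metric.ball (0 : V) r, ∀ t ∈ Icc (0 : ℝ) 1, t • v ∈ Metric.ball (0 : V) r := by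
    intro v hv t ht
    rw [mem_ball_zero_iff, norm_smul, Real.norm_of_nonneg ht.1] at *
    exact (mul_le_of_le_one_left (norm_nonneg v) ht.2).trans_lt hv
  have hΓb : ∀ p ∈ Metric.ball (0 : V) r, ‖Γ p‖ ≤ C := fun p hp ↦
    (hbd p (Metric.ball_subset_ball hr0 hp)).1
  have hDb : ∀ p ∈ Metric.ball (0 : V) r, ‖fderiv ℝ Γ p‖ ≤ C := fun p hp ↦
    (hbd p (Metric.ball_subset_ball hr0 hp)).2.1
  have hDΓ : ∀ p ∈ Metric.ball (0 : V) r, HasFDerivAt Γ (fderiv ℝ Γ p) p := fun p hp ↦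
    (hbd p (Metric.ball_subset_ball hr0 hp)).2.2
  have hsmall : ∀ p ∈ Metric.ball (0 : V) r, ∀ v ∈ Metric.ball (0 : V) r, ‖Γ p v‖ ≤ 1 / 2 := by
    intro p hp v hv
    calc ‖Γ p v‖ ≤ ‖Γ p‖ * ‖v‖ := (Γ p).le_opNorm v
      _ ≤ C * r := by
        gcongr
        · exact hΓb p hp
        · exact (mem_ball_zero_iff.1 hv).le
      _ ≤ 1 / 2 := hCr
  -- derivative of the coefficient along a ray
  have hray : ∀ v ∈ Metric.ball (0 : V) r, ∀ t ∈ Icc (0 : ℝ) 1,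
      HasDerivWithinAt (fun t : ℝ ↦ Γ (t • v)) (fderiv ℝ Γ (t • v) v) (Icc 0 1) t := by
    intro v hv t ht
    have h1 : HasDerivWithinAt (fun t : ℝ ↦ t • v) v (Icc 0 1) t := by
      simpa using (hasDerivWithinAt_id t (Icc (0 : ℝ) 1)).smul_const v
    exact (hDΓ _ (hball v hv t ht)).comp_hasDerivWithinAt t h1
  have hsol : ∀ v : V, ∃ γ : ℝ → G, v ∈ Metric.ball (0 : V) r → (γ 0 = c₀ ∧
      (∀ t ∈ Icc (0 : ℝ) 1, HasDerivWithinAt γ (-(Γ (t • v) v (γ t))) (Icc 0 1) t) ∧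
      ∀ t ∈ Icc (0 : ℝ) 1, ‖γ t‖ ≤ 2 * ‖c₀‖) := by
    intro v
    by_cases hv : v ∈ Metric.ball (0 : V) r
    · obtain ⟨γ, h⟩ := exists_linear_ode_solution (A := fun t ↦ -(Γ (t • v) v))
        (fun t ht ↦ ((hray v hv t ht).continuousWithinAt.clm_apply
          continuousWithinAt_const).neg)
        (fun t ht ↦ by rw [norm_neg]; exact hsmall _ (hball v hv t ht) v hv) c₀
      exact ⟨γ, fun _ ↦ h⟩
    · exact ⟨0, fun h ↦ absurd h hv⟩
  choose γ hγ using hsol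
  set m := 2 * ‖c₀‖ with hm
  have hm0 : 0 ≤ m := by positivity
  -- the solutions depend differentiably on the ray
  have hmain : ∀ v ∈ Metric.ball (0 : V) r, ∀ w ∈ Metric.ball (0 : V) r,
      ‖γ w 1 - γ v 1 + Γ v (w - v) (γ v 1)‖ ≤
        2 * ((2 * C * m + 8 * C ^ 2 * m) * ‖w - v‖ ^ 2) := by
    intro v hv w hw
    obtain ⟨hv0, hv1, hv2⟩ := hγ v hv
    obtain ⟨hw0, hw1, hw2⟩ := hγ w hw
    set h := w - v with hh
    have hwv : w = v + h := by rw [hh]; abel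
    have hv1' : ‖v‖ ≤ 1 := (mem_ball_zero_iff.1 hv).le.trans hr1'
    have hw1' : ‖w‖ ≤ 1 := (mem_ball_zero_iff.1 hw).le.trans hr1'
    have hlip' : ∀ t ∈ Icc (0 : ℝ) 1, ‖Γ (t • w) - Γ (t • v)‖ ≤ C * ‖h‖ := by
      intro t ht
      have := (htay (t • v) (Metric.ball_subset_ball hr0 (hball v hv t ht)) (t • w)
        (Metric.ball_subset_ball hr0 (hball w hw t ht))).1
      rw [← smul_sub, ← hh, norm_smul, Real.norm_of_nonneg ht.1] at this
      refine this.trans ?_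
      gcongr
      exact mul_le_of_le_one_left (norm_nonneg h) ht.2
    have htay' : ∀ t ∈ Icc (0 : ℝ) 1,
        ‖Γ (t • w) - Γ (t • v) - t • fderiv ℝ Γ (t • v) h‖ ≤ C * ‖h‖ ^ 2 := by
      intro t ht
      have := htay (t • v) (Metric.ball_subset_ball hr0 (hball v hv t ht)) (t • w)
        (Metric.ball_subset_ball hr0 (hball w hw t ht)) |>.2
      rw [← smul_sub, ← hh, map_smul, norm_smul, Real.norm_of_nonneg ht.1] at this
      refine this.trans ?_
      have := ht.1
      gcongr
      exact mul_le_of_le_one_left (norm_nonneg h) ht.2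
    have hDt : ∀ t ∈ Icc (0 : ℝ) 1, ‖t • fderiv ℝ Γ (t • v) h‖ ≤ C * ‖h‖ := by
      intro t ht
      rw [norm_smul, Real.norm_of_nonneg ht.1]
      refine (mul_le_of_le_one_left (norm_nonneg _) ht.2).trans ?_
      exact (ContinuousLinearMap.le_opNorm _ _).trans
        (mul_le_mul_of_nonneg_right (hDb _ (hball v hv t ht)) (norm_nonneg h))
    have op : ∀ (L : V →L[ℝ] G →L[ℝ] G) (u : V) (g : G), ‖L u g‖ ≤ ‖L‖ * ‖u‖ * ‖g‖ :=
      fun L u g ↦ L.le_opNorm₂ u g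
    -- Lipschitz estimate
    have hLip : ∀ t ∈ Icc (0 : ℝ) 1, ‖γ w t - γ v t‖ ≤ 2 * (2 * C * ‖h‖ * m) := by
      intro t ht
      refine norm_le_of_norm_deriv_le_of_eq_zero (f := fun t ↦ γ w t - γ v t) (by positivity)
        (fun t ht ↦ (hw1 t ht).sub (hv1 t ht)) (by simp [hv0, hw0]) (fun t ht ↦ ?_) ht
      have e : -(Γ (t • w) w (γ w t)) - -(Γ (t • v) v (γ v t)) =
          -(Γ (t • v) v (γ w t - γ v t)) - (Γ (t • w) - Γ (t • v)) w (γ w t)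
            - Γ (t • v) h (γ w t) := by
        simp only [hh, map_sub, sub_apply]
        abel
      rw [e]
      have b1 : ‖Γ (t • v) v (γ w t - γ v t)‖ ≤ ‖γ w t - γ v t‖ := by
        refine ((Γ (t • v) v).le_opNorm _).trans ?_
        have := hsmall _ (hball v hv t ht) v hv
        exact mul_le_of_le_one_left (norm_nonneg _) (by linarith)
      have b2 : ‖(Γ (t • w) - Γ (t • v)) w (γ w t)‖ ≤ C * ‖h‖ * 1 * m := by
        refine (op _ _ _).trans ?_
        gcongr
        · exact hlip' t ht
        · exact hw2 t ht
      have b3 : ‖Γ (t • v) h (γ w t)‖ ≤ C * ‖h‖ * m := by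
        refine (op _ _ _).trans ?_
        gcongr
        · exact hΓb _ (hball v hv t ht)
        · exact hw2 t ht
      have b4 := norm_sub_le (-(Γ (t • v) v (γ w t - γ v t))
        - (Γ (t • w) - Γ (t • v)) w (γ w t)) (Γ (t • v) h (γ w t))
      have b5 := norm_sub_le (-(Γ (t • v) v (γ w t - γ v t)))
        ((Γ (t • w) - Γ (t • v)) w (γ w t))
      rw [norm_neg] at b5
      linarith
    -- the error term of the expected derivative
    set δ : ℝ → G := fun t ↦ γ w t - γ v t + t • Γ (t • v) h (γ v t) with hδ
    have hδ' : ∀ t ∈ Icc (0 : ℝ) 1, HasDerivWithinAt δ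
        (-(Γ (t • w) w (γ w t)) - -(Γ (t • v) v (γ v t)) +
          (t • (fderiv ℝ Γ (t • v) v h (γ v t) + Γ (t • v) h (-(Γ (t • v) v (γ v t)))) +
            (1 : ℝ) • Γ (t • v) h (γ v t))) (Icc 0 1) t := fun t ht ↦ by
      have d1 : HasDerivWithinAt (fun t ↦ Γ (t • v) h) (fderiv ℝ Γ (t • v) v h) (Icc 0 1) t := by
        simpa using (hray v hv t ht).clm_apply (hasDerivWithinAt_const t _ h)
      exact ((hw1 t ht).sub (hv1 t ht)).add
        ((hasDerivWithinAt_id t _).smul (d1.clm_apply (hv1 t ht)))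
    have hfinal := norm_le_of_norm_deriv_le_of_eq_zero (f := δ)
      (ε := (2 * C * m + 8 * C ^ 2 * m) * ‖h‖ ^ 2) (by positivity) hδ'
      (by simp [hδ, hv0, hw0]) (fun t ht ↦ ?_) (right_mem_Icc.2 zero_le_one)
    · simpa [hδ] using hfinal
    have hfl := congrArg (fun L ↦ L (γ v t))
      (hflat _ (Metric.ball_subset_ball hr1 (hball v hv t ht)) v h)
    simp only [sub_apply, add_apply, ContinuousLinearMap.comp_apply, zero_apply] at hfl
    set R₁ := (Γ (t • w) - Γ (t • v) - t • fderiv ℝ Γ (t • v) h) v (γ w t) with hR₁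
    set R₂ := (t • fderiv ℝ Γ (t • v) h) v (γ w t - γ v t) with hR₂
    set R₃ := (Γ (t • w) - Γ (t • v)) h (γ w t) with hR₃
    set R₄ := Γ (t • v) h (γ w t - γ v t) with hR₄
    -- flatness makes the terms of first order in `h` cancel
    have e : -(Γ (t • w) w (γ w t)) - -(Γ (t • v) v (γ v t)) +
          (t • (fderiv ℝ Γ (t • v) v h (γ v t) + Γ (t • v) h (-(Γ (t • v) v (γ v t)))) +
            (1 : ℝ) • Γ (t • v) h (γ v t)) = -(Γ (t • v) v (δ t)) - R₁ - R₂ - R₃ - R₄ := by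
      have hw' : Γ (t • w) w = Γ (t • w) v + Γ (t • w) h := by rw [← map_add, ← hwv]
      simp only [hR₁, hR₂, hR₃, hR₄, hδ, hw', map_sub, map_add, map_smul, map_neg, sub_apply,
        add_apply, smul_apply]
      linear_combination (norm := module) t • hfl
    rw [e]
    have b0 : ‖Γ (t • v) v (δ t)‖ ≤ ‖δ t‖ := by
      refine ((Γ (t • v) v).le_opNorm _).trans ?_
      have := hsmall _ (hball v hv t ht) v hv
      exact mul_le_of_le_one_left (norm_nonneg _) (by linarith)
    have b1 : ‖R₁‖ ≤ C * ‖h‖ ^ 2 * 1 * m := by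
      refine (op _ _ _).trans ?_
      gcongr
      · exact htay' t ht
      · exact hw2 t ht
    have b2 : ‖R₂‖ ≤ C * ‖h‖ * 1 * (2 * (2 * C * ‖h‖ * m)) := by
      refine (op _ _ _).trans ?_
      gcongr
      · exact hDt t ht
      · exact hLip t ht
    have b3 : ‖R₃‖ ≤ C * ‖h‖ * ‖h‖ * m := by
      refine (op _ _ _).trans ?_
      gcongr
      · exact hlip' t ht
      · exact hw2 t ht
    have b4 : ‖R₄‖ ≤ C * ‖h‖ * (2 * (2 * C * ‖h‖ * m)) := by
      refine (op _ _ _).trans ?_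
      gcongr
      · exact hΓb _ (hball v hv t ht)
      · exact hLip t ht
    have c1 := norm_sub_le (-(Γ (t • v) v (δ t)) - R₁ - R₂ - R₃) R₄
    have c2 := norm_sub_le (-(Γ (t • v) v (δ t)) - R₁ - R₂) R₃
    have c3 := norm_sub_le (-(Γ (t • v) v (δ t)) - R₁) R₂
    have c4 := norm_sub_le (-(Γ (t • v) v (δ t))) R₁
    rw [norm_neg] at c4
    nlinarith
  refine ⟨r, hr, fun v ↦ γ v 1, ?_, fun v hv ↦ ?_⟩
  · obtain ⟨h0, h1, -⟩ := hγ 0 (Metric.mem_ball_self hr)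
    have hz := norm_le_of_norm_deriv_le_of_eq_zero (f := fun t ↦ γ 0 t - c₀) (f' := fun _ ↦ 0)
      le_rfl (fun t ht ↦ by simpa using (h1 t ht).sub_const c₀) (by simp [h0])
      (fun t _ ↦ by simp) (right_mem_Icc.2 zero_le_one)
    simpa [sub_eq_zero] using hz
  · rw [hasFDerivAt_iff_isLittleO]
    refine Asymptotics.IsBigO.trans_isLittleO (g := fun w ↦ ‖w - v‖ ^ 2) ?_ ?_
    · refine Asymptotics.IsBigO.of_bound (2 * (2 * C * m + 8 * C ^ 2 * m)) ?_
      filter_upwards [Metric.isOpen_ball.mem_nhds hv] with w hw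
      have := hmain v hv w hw
      simp only [neg_apply, ContinuousLinearMap.flip_apply, sub_neg_eq_add, norm_pow, norm_norm]
      linarith
    · have h1 : (fun w ↦ w - v) =o[𝓝 v] (fun _ ↦ (1 : ℝ)) := by
        rw [Asymptotics.isLittleO_one_iff]
        have : Tendsto (fun w : V ↦ w - v) (𝓝 v) (𝓝 (v - v)) :=
          (continuous_id.sub continuous_const).tendsto v
        simpa using this
      have h2 := h1.norm_left.mul_isBigO
        ((Asymptotics.isBigO_refl (fun w : V ↦ w - v) (𝓝 v)).norm_left.norm_right)
      simpa [sq] using h2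

/-- Bootstrapping: if `c` is `C^n`, so is the right-hand side, and `c` is `C^(n+1)`. -/
theorem contDiffOn_of_hasFDerivAt_linear {Γ : V → V →L[ℝ] G →L[ℝ] G} {c : V → G} {U : Set V}
    (hU : IsOpen U) (hΓ : ContDiffOn ℝ ∞ Γ U)
    (hc : ∀ p ∈ U, HasFDerivAt c (-((Γ p).flip (c p))) p) : ContDiffOn ℝ ∞ c U := by
  rw [contDiffOn_infty]
  intro n
  induction n with
  | zero => exact contDiffOn_zero.2 fun p hp ↦ (hc p hp).continuousAt.continuousWithinAt
  | succ n ih =>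
    rw [Nat.cast_add, Nat.cast_one, contDiffOn_succ_iff_fderiv_of_isOpen hU]
    refine ⟨fun p hp ↦ (hc p hp).differentiableAt.differentiableWithinAt, by simp, ?_⟩
    have hΓn : ContDiffOn ℝ n Γ U := hΓ.of_le (mod_cast le_top)
    have h1 : ContDiffOn ℝ n (fun p ↦ (Γ p).flip) U :=
      (ContinuousLinearMap.flipₗᵢ ℝ V G G).contDiff.comp_contDiffOn hΓn
    exact (h1.clm_apply ih).neg.congr fun p hp ↦ (hc p hp).fderiv

/-- Local solvability of `dc = -Γ c` for smooth flat `Γ`, with a smooth solution. -/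
theorem exists_smooth_solution_of_flat [CompleteSpace G] {Γ : V → V →L[ℝ] G →L[ℝ] G}
    {Ω : Set V} (hΩ : IsOpen Ω) (hΓ : ContDiffOn ℝ ∞ Γ Ω)
    (flat : ∀ p ∈ Ω, ∀ a b, fderiv ℝ Γ p a b - fderiv ℝ Γ p b a + (Γ p a).comp (Γ p b)
      - (Γ p b).comp (Γ p a) = 0) {p₀ : V} (hp₀ : p₀ ∈ Ω) (c₀ : G) :
    ∃ U ⊆ Ω, IsOpen U ∧ p₀ ∈ U ∧ ∃ c : V → G, c p₀ = c₀ ∧ ContDiffOn ℝ ∞ c U ∧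
      ∀ p ∈ U, HasFDerivAt c (-((Γ p).flip (c p))) p := by
  have hsh : Tendsto (fun p : V ↦ p + p₀) (𝓝 0) (𝓝 p₀) := by
    have h := (continuous_add_const p₀).tendsto (0 : V)
    rwa [zero_add] at h
  have h0 : ContDiffAt ℝ 2 (fun p ↦ Γ (p + p₀)) 0 := by
    have h1 : ContDiffAt ℝ 2 Γ (0 + p₀) := by
      rw [zero_add]
      exact (hΓ.contDiffAt (hΩ.mem_nhds hp₀)).of_le
        (WithTop.coe_le_coe.2 (le_top : (2 : ℕ∞) ≤ ⊤))
    exact h1.comp 0 (contDiffAt_id.add contDiffAt_const)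
  obtain ⟨r, hr, c, hc0, hc⟩ := exists_hasFDerivAt_of_flat h0 (by
    filter_upwards [hsh.eventually (hΩ.mem_nhds hp₀)] with p hp a b
    rw [fderiv_comp_add_right]
    exact flat _ hp a b) c₀
  have hc' : ∀ p ∈ Metric.ball p₀ r ∩ Ω,
      HasFDerivAt (fun p ↦ c (p - p₀)) (-((Γ p).flip (c (p - p₀)))) p := by
    intro p hp
    have h1 := hc (p - p₀) (by simpa [dist_eq_norm] using hp.1)
    rw [sub_add_cancel] at h1
    simpa using! h1.comp p ((hasFDerivAt_id p).sub_const p₀)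
  have hUo : IsOpen (Metric.ball p₀ r ∩ Ω) := Metric.isOpen_ball.inter hΩ
  exact ⟨Metric.ball p₀ r ∩ Ω, inter_subset_right, hUo,
    ⟨Metric.mem_ball_self hr, hp₀⟩, fun p ↦ c (p - p₀), by simp [hc0],
    contDiffOn_of_hasFDerivAt_linear hUo (hΓ.mono inter_subset_right) hc', hc'⟩

end FlatPotential

section Connections

variable {E : Type*} [NormedAddCommGroup E] [NormedSpace ℝ E]
  {M : Type*} [TopologicalSpace M] [ChartedSpace E M] [IsManifold 𝓘(ℝ, E) ∞ M]
  {F : Type*} [NormedAddCommGroup F] [NormedSpace ℝ F]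
  {W : M → Type*} [TopologicalSpace (TotalSpace F W)]
  [∀ x, AddCommGroup (W x)] [∀ x, Module ℝ (W x)] [∀ x, TopologicalSpace (W x)]
  [∀ x, IsTopologicalAddGroup (W x)] [∀ x, ContinuousSMul ℝ (W x)]
  [FiberBundle F W]

/-! ### Local calculus of the covariant derivative and the curvature -/

variable [VectorBundle ℝ F W] [ContMDiffVectorBundle ∞ F W 𝓘(ℝ, E)]
  (cov : CovariantDerivative 𝓘(ℝ, E) F W)

theorem mdifferentiableAt_of_smoothOn {U : Set M} (hU : IsOpen U) {X : ∀ x, W x}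
    (hX : CMDiff[U] ∞ (T% X)) {x : M} (hx : x ∈ U) : MDiffAt (T% X) x :=
  (hX.contMDiffAt (hU.mem_nhds hx)).mdifferentiableAt (by simp)

theorem smooth_mvfderiv_apply {U : Set M} (hU : IsOpen U) {f : M → ℝ} (hf : CMDiff[U] ∞ f)
    {A : ∀ x : M, TangentSpace 𝓘(ℝ, E) x} (hA : CMDiff[U] ∞ (T% A)) :
    CMDiff[U] ∞ (fun y ↦ d% f y (A y)) := by
  have h1 := hf.contMDiffOn_tangentMapWithin (m := ∞) (by simp) hU.uniqueMDiffOn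
  have h2 := h1.comp hA (fun y hy ↦ hy)
  have h3 := (contMDiff_snd_tangentBundle_modelSpace (n := ∞) ℝ 𝓘(ℝ, ℝ)).comp_contMDiffOn h2
  refine h3.congr fun y hy ↦ ?_
  change _ = mfderivWithin 𝓘(ℝ, E) 𝓘(ℝ, ℝ) f U y (A y)
  rw [mfderivWithin_of_isOpen hU hy]
  rfl

/-- A connection that maps global smooth sections to smooth sections also maps local smooth
sections to smooth sections: multiply by a bump function. -/
theorem cov_smooth [T2Space M] [FiniteDimensional ℝ E]
    [CovariantDerivative.ContMDiffCovariantDerivative cov ∞]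
    {U : Set M} (hU : IsOpen U) {X : ∀ x, W x} (hX : CMDiff[U] ∞ (T% X)) :
    ContMDiffOn 𝓘(ℝ, E) (𝓘(ℝ, E).prod 𝓘(ℝ, E →L[ℝ] F)) ∞
      (fun x ↦ TotalSpace.mk' (E →L[ℝ] F)
        (E := fun x ↦ TangentSpace 𝓘(ℝ, E) x →L[ℝ] W x) x (cov X x)) U := by
  intro x hx
  obtain ⟨f, -, hf⟩ :=
    (SmoothBumpFunction.nhds_basis_tsupport (I := 𝓘(ℝ, E)) x).mem_iff.1 (hU.mem_nhds hx)
  have h1 : CMDiff ∞ (T% ((f : M → ℝ) • X)) :=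
    ContMDiffOn.smul_section_of_tsupport f.contMDiff.contMDiffOn hU hf hX
  have h2 := (CovariantDerivative.ContMDiffCovariantDerivative.contMDiff
    (cov := cov) (k := ∞)).contMDiff (σ := (f : M → ℝ) • X) (by simpa using h1.contMDiffOn)
  refine ((h2.contMDiffAt univ_mem).congr_of_eventuallyEq ?_).contMDiffWithinAt
  filter_upwards [f.eventuallyEq_one.eventuallyEq_nhds, hU.mem_nhds hx] with y hy hyU
  congr 1
  refine cov.isCovariantDerivativeOn.congr_of_eventuallyEq (s := univ)
    (mdifferentiableAt_of_smoothOn hU hX hyU)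
    (mdifferentiableAt_of_smoothOn isOpen_univ h1.contMDiffOn (mem_univ y)) univ_mem ?_
  filter_upwards [hy] with z hz
  simp [hz]

theorem covApply_smooth [T2Space M] [FiniteDimensional ℝ E]
    [CovariantDerivative.ContMDiffCovariantDerivative cov ∞]
    {U : Set M} (hU : IsOpen U) {X : ∀ x, W x} (hX : CMDiff[U] ∞ (T% X))
    {A : ∀ x : M, TangentSpace 𝓘(ℝ, E) x} (hA : CMDiff[U] ∞ (T% A)) :
    CMDiff[U] ∞ (T% (fun y ↦ cov X y (A y))) :=
  (cov_smooth cov hU hX).clm_bundle_apply (E₁ := fun x ↦ TangentSpace 𝓘(ℝ, E) x) (b := id) hA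

theorem cov_congr {U : Set M} (hU : IsOpen U) {X Y : ∀ x, W x} (hX : CMDiff[U] ∞ (T% X))
    (hXY : ∀ y ∈ U, Y y = X y) {x : M} (hx : x ∈ U) : cov Y x = cov X x := by
  have hY : CMDiff[U] ∞ (T% Y) := hX.congr fun y hy ↦ by simp [hXY y hy]
  exact cov.isCovariantDerivativeOn.congr_of_eqOn (mdifferentiableAt_of_smoothOn hU hY hx)
    (mdifferentiableAt_of_smoothOn hU hX hx) (hU.mem_nhds hx) hXY

theorem mlieBracket_smooth [FiniteDimensional ℝ E] {U : Set M} (hU : IsOpen U)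
    {A B : ∀ x : M, TangentSpace 𝓘(ℝ, E) x} (hA : CMDiff[U] ∞ (T% A)) (hB : CMDiff[U] ∞ (T% B)) :
    CMDiff[U] ∞ (T% (VectorField.mlieBracket 𝓘(ℝ, E) A B)) := fun x hx ↦
  have : IsManifold 𝓘(ℝ, E) (((⊤ : ℕ∞) : WithTop ℕ∞) + 1) M := by simpa
  have : IsManifold 𝓘(ℝ, E) (minSmoothness ℝ 2) M := by
    simp only [minSmoothness_of_isRCLikeNormedField]; infer_instance
  (ContMDiffAt.mlieBracket_vectorField (m := ⊤) (n := ⊤) (hA.contMDiffAt (hU.mem_nhds hx))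
    (hB.contMDiffAt (hU.mem_nhds hx)) (by simp)).contMDiffWithinAt

/-- The derivation along the Lie bracket is the commutator of the derivations. This follows from
the Jacobi identity for `A`, `B` and `f • C`, where `C` is a field that does not vanish at `x`. -/
theorem mvfderiv_mlieBracket [FiniteDimensional ℝ E] {U : Set M} (hU : IsOpen U) {f : M → ℝ}
    (hf : CMDiff[U] ∞ f)
    {A B : ∀ x : M, TangentSpace 𝓘(ℝ, E) x} (hA : CMDiff[U] ∞ (T% A)) (hB : CMDiff[U] ∞ (T% B))
    {x : M} (hx : x ∈ U) :
    d% f x (VectorField.mlieBracket 𝓘(ℝ, E) A B x) =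
      d% (fun y ↦ d% f y (B y)) x (A x) - d% (fun y ↦ d% f y (A y)) x (B x) := by
  rcases subsingleton_or_nontrivial E with hE | hE
  · have h0 : ∀ u : TangentSpace 𝓘(ℝ, E) x, u = 0 := fun u ↦ Subsingleton.elim (α := E) u 0
    rw [h0 (A x), h0 (B x), h0 (VectorField.mlieBracket 𝓘(ℝ, E) A B x)]
    simp
  obtain ⟨w, hw⟩ : ∃ w : TangentSpace 𝓘(ℝ, E) x, w ≠ 0 := exists_ne (α := E) 0
  obtain ⟨s, hs, hsC⟩ := FiberBundle.exists_contMDiffOn_extend 𝓘(ℝ, E) E (k := ∞) w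
  obtain ⟨V, hVs, hV, hxV⟩ := mem_nhds_iff.1 (Filter.inter_mem hs (hU.mem_nhds hx))
  set C := FiberBundle.extend E w with hCdef
  have hC : CMDiff[V] ∞ (T% C) := hsC.mono fun y hy ↦ (hVs hy).1
  have hVU : V ⊆ U := fun y hy ↦ (hVs hy).2
  replace hA := hA.mono hVU
  replace hB := hB.mono hVU
  replace hf := hf.mono hVU
  have md : ∀ {Z : ∀ x : M, TangentSpace 𝓘(ℝ, E) x}, CMDiff[V] ∞ (T% Z) → ∀ y ∈ V,
      MDiffAt (T% Z) y := fun hZ y hy ↦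
    (hZ.contMDiffAt (hV.mem_nhds hy)).mdifferentiableAt (by simp)
  have mf : ∀ {g : M → ℝ}, CMDiff[V] ∞ g → ∀ y ∈ V, MDiffAt g y := fun hg y hy ↦
    (hg.contMDiffAt (hV.mem_nhds hy)).mdifferentiableAt (by simp)
  have key : ∀ {P Q : ∀ x : M, TangentSpace 𝓘(ℝ, E) x}, CMDiff[V] ∞ (T% P) →
      CMDiff[V] ∞ (T% Q) →
      VectorField.mlieBracket 𝓘(ℝ, E) P (VectorField.mlieBracket 𝓘(ℝ, E) Q (f • C)) x =
        d% (fun y ↦ d% f y (Q y)) x (P x) • C x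
          + d% f x (Q x) • VectorField.mlieBracket 𝓘(ℝ, E) P C x
          + (d% f x (P x) • VectorField.mlieBracket 𝓘(ℝ, E) Q C x
          + f x • VectorField.mlieBracket 𝓘(ℝ, E) P
            (VectorField.mlieBracket 𝓘(ℝ, E) Q C) x) := fun {P Q} hP hQ ↦ by
    have h1 := smooth_mvfderiv_apply hV hf hQ
    have h2 := mlieBracket_smooth hV hQ hC
    have e : VectorField.mlieBracket 𝓘(ℝ, E) Q (f • C) =ᶠ[𝓝 x]
        ((fun y ↦ d% f y (Q y)) • C + f • VectorField.mlieBracket 𝓘(ℝ, E) Q C) := by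
      filter_upwards [hV.mem_nhds hxV] with y hy
      rw [VectorField.mlieBracket_smul_right (mf hf y hy) (md hC y hy)]
      rfl
    rw [Filter.EventuallyEq.mlieBracket_vectorField_eq (V := P) Filter.EventuallyEq.rfl e,
      VectorField.mlieBracket_add_right (md (h1.smul_section hC) x hxV)
        (md (hf.smul_section h2) x hxV),
      VectorField.mlieBracket_smul_right (mf h1 x hxV) (md hC x hxV),
      VectorField.mlieBracket_smul_right (mf hf x hxV) (md h2 x hxV)]
  have at2 : ∀ {Z : ∀ x : M, TangentSpace 𝓘(ℝ, E) x}, CMDiff[V] ∞ (T% Z) →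
      CMDiffAt (minSmoothness ℝ 2) (T% Z) x := fun hZ ↦
    (hZ.contMDiffAt (hV.mem_nhds hxV)).of_le (by
      simpa using WithTop.coe_le_coe.2 (le_top : (2 : ℕ∞) ≤ ⊤))
  have : IsManifold 𝓘(ℝ, E) (minSmoothness ℝ 3) M := by
    simp only [minSmoothness_of_isRCLikeNormedField]; infer_instance
  have jac := VectorField.leibniz_identity_mlieBracket_apply (at2 hA) (at2 hB)
    (at2 (hf.smul_section hC))
  have jac' := VectorField.leibniz_identity_mlieBracket_apply (at2 hA) (at2 hB) (at2 hC)
  rw [key hA hB, key hB hA, VectorField.mlieBracket_smul_right (mf hf x hxV) (md hC x hxV),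
    jac'] at jac
  have hCx : C x = w := FiberBundle.extend_apply_self E w
  have e0 : (d% f x (VectorField.mlieBracket 𝓘(ℝ, E) A B x) -
      (d% (fun y ↦ d% f y (B y)) x (A x) - d% (fun y ↦ d% f y (A y)) x (B x))) • C x = 0 := by
    rw [sub_smul, sub_smul, sub_eq_zero]
    linear_combination (norm := module) (-1 : ℝ) • jac
  rw [hCx] at e0
  exact sub_eq_zero.1 ((smul_eq_zero.1 e0).resolve_right hw)

variable {cov}

theorem curvatureOp_congr [T2Space M] [FiniteDimensional ℝ E]
    [CovariantDerivative.ContMDiffCovariantDerivative cov ∞] {U : Set M} (hU : IsOpen U)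
    {A B : ∀ x : M, TangentSpace 𝓘(ℝ, E) x} (hA : CMDiff[U] ∞ (T% A)) (hB : CMDiff[U] ∞ (T% B))
    {X Y : ∀ x, W x} (hX : CMDiff[U] ∞ (T% X)) (hXY : ∀ y ∈ U, Y y = X y) {x : M} (hx : x ∈ U) :
    curvatureOp cov A B Y x = curvatureOp cov A B X x := by
  have key : ∀ {C : ∀ x : M, TangentSpace 𝓘(ℝ, E) x}, CMDiff[U] ∞ (T% C) →
      cov (fun y ↦ cov Y y (C y)) x = cov (fun y ↦ cov X y (C y)) x := fun hC ↦
    cov_congr cov hU (covApply_smooth cov hU hX hC)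
      (fun y hy ↦ by rw [cov_congr cov hU hX hXY hy]) hx
  unfold curvatureOp
  rw [cov_congr cov hU hX hXY hx, key hA, key hB]

theorem cov_add {U : Set M} (hU : IsOpen U) {X Y : ∀ x, W x} (hX : CMDiff[U] ∞ (T% X))
    (hY : CMDiff[U] ∞ (T% Y)) {x : M} (hx : x ∈ U) : cov (X + Y) x = cov X x + cov Y x :=
  cov.isCovariantDerivativeOn.add (s := univ) (mdifferentiableAt_of_smoothOn hU hX hx)
    (mdifferentiableAt_of_smoothOn hU hY hx)

theorem cov_smul {U : Set M} (hU : IsOpen U) {f : M → ℝ} {X : ∀ x, W x} (hf : CMDiff[U] ∞ f)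
    (hX : CMDiff[U] ∞ (T% X)) {x : M} (hx : x ∈ U) (u : TangentSpace 𝓘(ℝ, E) x) :
    cov (f • X) x u = f x • cov X x u + d% f x u • X x := by
  rw [cov.isCovariantDerivativeOn.leibniz (s := univ) (mdifferentiableAt_of_smoothOn hU hX hx)
    ((hf.contMDiffAt (hU.mem_nhds hx)).mdifferentiableAt (by simp))]
  rfl

theorem cov_sum {ι : Type*} {s : Finset ι} {U : Set M} (hU : IsOpen U) {X : ι → ∀ x, W x}
    (hX : ∀ i ∈ s, CMDiff[U] ∞ (T% (X i))) {x : M} (hx : x ∈ U) :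
    cov (fun y ↦ ∑ i ∈ s, X i y) x = ∑ i ∈ s, cov (X i) x := by
  classical
  induction s using Finset.induction_on with
  | empty =>
    simp only [Finset.sum_empty]
    exact congrFun cov.zero x
  | insert a s ha ih =>
    simp only [Finset.mem_insert, forall_eq_or_imp] at hX
    simp only [Finset.sum_insert ha, ← ih hX.2]
    exact cov_add hU hX.1 (.sum_section hX.2) hx

theorem curvatureOp_add [T2Space M] [FiniteDimensional ℝ E]
    [CovariantDerivative.ContMDiffCovariantDerivative cov ∞] {U : Set M} (hU : IsOpen U)
    {A B : ∀ x : M, TangentSpace 𝓘(ℝ, E) x} (hA : CMDiff[U] ∞ (T% A)) (hB : CMDiff[U] ∞ (T% B))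
    {X Y : ∀ x, W x} (hX : CMDiff[U] ∞ (T% X)) (hY : CMDiff[U] ∞ (T% Y)) {x : M} (hx : x ∈ U) :
    curvatureOp cov A B (X + Y) x = curvatureOp cov A B X x + curvatureOp cov A B Y x := by
  have key : ∀ {C : ∀ x : M, TangentSpace 𝓘(ℝ, E) x}, CMDiff[U] ∞ (T% C) →
      cov (fun y ↦ cov (X + Y) y (C y)) x =
        cov (fun y ↦ cov X y (C y)) x + cov (fun y ↦ cov Y y (C y)) x := fun {C} hC ↦ by
    rw [← cov_add hU (covApply_smooth cov hU hX hC) (covApply_smooth cov hU hY hC) hx]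
    refine cov_congr cov hU
      ((covApply_smooth cov hU hX hC).add_section (covApply_smooth cov hU hY hC)) ?_ hx
    intro y hy
    rw [cov_add hU hX hY hy]
    rfl
  unfold curvatureOp
  rw [key hA, key hB, cov_add hU hX hY hx]
  simp only [add_apply]
  abel

/-- The curvature operator is linear over functions in the section: the second derivatives of `f`
cancel against the derivative of `f` along the bracket. -/
theorem curvatureOp_smul [T2Space M] [FiniteDimensional ℝ E]
    [CovariantDerivative.ContMDiffCovariantDerivative cov ∞] {U : Set M} (hU : IsOpen U)
    {A B : ∀ x : M, TangentSpace 𝓘(ℝ, E) x} (hA : CMDiff[U] ∞ (T% A)) (hB : CMDiff[U] ∞ (T% B))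
    {f : M → ℝ} (hf : CMDiff[U] ∞ f)
    {X : ∀ x, W x} (hX : CMDiff[U] ∞ (T% X)) {x : M} (hx : x ∈ U) :
    curvatureOp cov A B (f • X) x = f x • curvatureOp cov A B X x := by
  have key : ∀ {C : ∀ x : M, TangentSpace 𝓘(ℝ, E) x}, CMDiff[U] ∞ (T% C) →
      ∀ u : TangentSpace 𝓘(ℝ, E) x, cov (fun y ↦ cov (f • X) y (C y)) x u =
        f x • cov (fun y ↦ cov X y (C y)) x u + d% f x u • cov X x (C x) +
        (d% f x (C x) • cov X x u + d% (fun y ↦ d% f y (C y)) x u • X x) := fun {C} hC u ↦ by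
    have h1 := covApply_smooth cov hU hX hC
    have h2 := smooth_mvfderiv_apply hU hf hC
    rw [← cov_smul hU hf h1 hx, ← cov_smul hU h2 hX hx, ← add_apply,
      ← cov_add hU (hf.smul_section h1) (h2.smul_section hX) hx]
    refine congrArg (· u) (cov_congr cov hU
      ((hf.smul_section h1).add_section (h2.smul_section hX)) ?_ hx)
    intro y hy
    rw [cov_smul hU hf hX hy]
    rfl
  unfold curvatureOp
  rw [key hA, key hB, cov_smul hU hf hX hx, mvfderiv_mlieBracket hU hf hA hB hx]
  module

/-- The extension that enters the definition of the curvature is smooth near the base point. -/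
theorem exists_isOpen_extend_smooth {x : M} (w : W x) :
    ∃ V : Set M, IsOpen V ∧ x ∈ V ∧ CMDiff[V] ∞ (T% (FiberBundle.extend F w)) := by
  obtain ⟨s, hs, h⟩ := FiberBundle.exists_contMDiffOn_extend 𝓘(ℝ, E) F (k := ∞) w
  obtain ⟨V, hVs, hV, hxV⟩ := mem_nhds_iff.1 hs
  exact ⟨V, hV, hxV, h.mono hVs⟩

/-- The curvature operator depends on `X` only through its value at the point: expand `X` in a local
frame and use linearity over functions. -/
theorem curvatureOp_eq_of_eq_at [T2Space M] [FiniteDimensional ℝ E] [FiniteDimensional ℝ F]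
    [CovariantDerivative.ContMDiffCovariantDerivative cov ∞] {U : Set M} (hU : IsOpen U)
    {A B : ∀ x : M, TangentSpace 𝓘(ℝ, E) x} (hA : CMDiff[U] ∞ (T% A)) (hB : CMDiff[U] ∞ (T% B))
    {X Y : ∀ x, W x} (hX : CMDiff[U] ∞ (T% X)) (hY : CMDiff[U] ∞ (T% Y)) {x : M} (hx : x ∈ U)
    (hXY : X x = Y x) :
    curvatureOp cov A B X x = curvatureOp cov A B Y x := by
  classical
  have : ContMDiffVectorBundle 1 F W 𝓘(ℝ, E) := .of_le (n := ∞) (by simp)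
  let t := trivializationAt F W x
  let V := U ∩ t.baseSet
  have hV : IsOpen V := hU.inter t.open_baseSet
  have hxV : x ∈ V := ⟨hx, FiberBundle.mem_baseSet_trivializationAt F W x⟩
  let b := Module.Basis.ofVectorSpace ℝ F
  let s := t.localFrame b
  let c := t.localFrameCoeff 𝓘(ℝ, E) b
  have hs : ∀ i, CMDiff[V] ∞ (T% (s i)) := fun i ↦
    (t.contMDiffOn_localFrame_baseSet (I := 𝓘(ℝ, E)) ∞ b i).mono inter_subset_right
  have hc : ∀ {Z : ∀ x, W x}, CMDiff[U] ∞ (T% Z) → ∀ i,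
      CMDiff[V] ∞ (LinearMap.piApply (c i) Z) := fun hZ i ↦
    contMDiffOn_localFrameCoeff b hV inter_subset_right
      (hZ.mono inter_subset_left) i
  have sum_smul : ∀ (S : Finset _) {Z : ∀ x, W x}, CMDiff[U] ∞ (T% Z) →
      curvatureOp cov A B (fun y ↦ ∑ i ∈ S, (LinearMap.piApply (c i) Z • s i) y) x =
        ∑ i ∈ S, c i x (Z x) • curvatureOp cov A B (s i) x := by
    intro S Z hZ
    induction S using Finset.induction_on with
    | empty =>
      have := curvatureOp_smul (cov := cov) hV (hA.mono inter_subset_left)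
        (hB.mono inter_subset_left) (f := fun _ ↦ 0) contMDiffOn_const
        (X := Z) (hZ.mono inter_subset_left) hxV
      rw [zero_smul] at this
      simp only [Finset.sum_empty]
      rw [← this]
      congr 1
      ext y
      simp
    | insert a S ha ih =>
      simp only [Finset.sum_insert ha, ← ih]
      have h1 := (hc hZ a).smul_section (hs a)
      have h2 : CMDiff[V] ∞ (T% (fun y ↦ ∑ i ∈ S, (LinearMap.piApply (c i) Z • s i) y)) :=
        .sum_section fun i _ ↦ (hc hZ i).smul_section (hs i)
      have h3 := curvatureOp_add (cov := cov) hV (hA.mono inter_subset_left)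
        (hB.mono inter_subset_left) h1 h2 hxV
      have h4 := curvatureOp_smul (cov := cov) hV (hA.mono inter_subset_left)
        (hB.mono inter_subset_left) (hc hZ a) (hs a) hxV
      rw [h4] at h3
      exact h3
  have expand : ∀ {Z : ∀ x, W x}, CMDiff[U] ∞ (T% Z) →
      curvatureOp cov A B Z x = ∑ i, c i x (Z x) • curvatureOp cov A B (s i) x := fun {Z} hZ ↦ by
    rw [← sum_smul Finset.univ hZ]
    refine (curvatureOp_congr hV (hA.mono inter_subset_left)
      (hB.mono inter_subset_left) (hZ.mono inter_subset_left) (fun y hy ↦ ?_) hxV).symm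
    exact (t.eq_sum_localFrameCoeff_smul (I := 𝓘(ℝ, E)) (s := Z) (b := b) hy.2).symm
  rw [expand hX, expand hY, hXY]

theorem curvatureOp_tensorial_left [T2Space M] [FiniteDimensional ℝ E]
    [CovariantDerivative.ContMDiffCovariantDerivative cov ∞] {U : Set M} (hU : IsOpen U)
    {B : ∀ x : M, TangentSpace 𝓘(ℝ, E) x} {X : ∀ x, W x} (hX : CMDiff[U] ∞ (T% X))
    {x : M} (hx : x ∈ U) :
    TensorialAt 𝓘(ℝ, E) E (fun A ↦ curvatureOp cov A B X x) x := by
  have md : ∀ {A : ∀ x : M, TangentSpace 𝓘(ℝ, E) x}, MDiffAt (T% A) x →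
      MDiffAt (T% (fun y ↦ cov X y (A y))) x := fun hA ↦
    MDifferentiableAt.clm_bundle_apply (E₁ := fun x : M ↦ TangentSpace 𝓘(ℝ, E) x)
      (E₂ := W) (F₁ := E) (F₂ := F) (b := id)
      (((cov_smooth cov hU hX).contMDiffAt (hU.mem_nhds hx)).mdifferentiableAt (by simp)) hA
  constructor
  · intro f A hf hA
    have h1 : (fun y ↦ cov X y ((f • A) y)) = f • (fun y ↦ cov X y (A y)) := by
      ext y; simp
    simp only [curvatureOp, h1]
    rw [VectorField.mlieBracket_smul_left hf hA,
      cov.isCovariantDerivativeOn.leibniz (s := univ) (md hA) hf]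
    simp
    module
  · intro A A' hA hA'
    have h1 : (fun y ↦ cov X y ((A + A') y)) =
        (fun y ↦ cov X y (A y)) + (fun y ↦ cov X y (A' y)) := by
      ext y; simp
    simp only [curvatureOp, h1]
    rw [VectorField.mlieBracket_add_left hA hA',
      cov.isCovariantDerivativeOn.add (s := univ) (md hA) (md hA')]
    simp
    module

theorem curvatureOp_swap (A B : ∀ x : M, TangentSpace 𝓘(ℝ, E) x) (X : ∀ x, W x) (x : M) :
    curvatureOp cov A B X x = - curvatureOp cov B A X x := by
  simp only [curvatureOp]
  rw [VectorField.mlieBracket_swap_apply, map_neg]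
  abel

/-- The curvature is a tensor: it may be computed with any smooth extensions of its arguments. -/
theorem curvature_eq_curvatureOp [T2Space M] [FiniteDimensional ℝ E] [FiniteDimensional ℝ F]
    [CovariantDerivative.ContMDiffCovariantDerivative cov ∞] {U : Set M} (hU : IsOpen U)
    {A B : ∀ x : M, TangentSpace 𝓘(ℝ, E) x} (hA : CMDiff[U] ∞ (T% A)) (hB : CMDiff[U] ∞ (T% B))
    {X : ∀ x, W x} (hX : CMDiff[U] ∞ (T% X)) {x : M} (hx : x ∈ U) :
    curvature cov x (A x) (B x) (X x) = curvatureOp cov A B X x := by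
  obtain ⟨V₁, hV₁, hx₁, hA'⟩ := exists_isOpen_extend_smooth (E := E) (F := E) (W := fun x : M ↦
    TangentSpace 𝓘(ℝ, E) x) (A x)
  obtain ⟨V₂, hV₂, hx₂, hB'⟩ := exists_isOpen_extend_smooth (E := E) (F := E) (W := fun x : M ↦
    TangentSpace 𝓘(ℝ, E) x) (B x)
  obtain ⟨V₃, hV₃, hx₃, hX'⟩ := exists_isOpen_extend_smooth (E := E) (F := F) (X x)
  have md : ∀ {A : ∀ x : M, TangentSpace 𝓘(ℝ, E) x}, ∀ V, IsOpen V → x ∈ V →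
      CMDiff[V] ∞ (T% A) → MDiffAt (T% A) x := fun V hV hx hA ↦
    (hA.contMDiffAt (hV.mem_nhds hx)).mdifferentiableAt (by simp)
  unfold curvature
  have e1 := (curvatureOp_tensorial_left (cov := cov) hV₃
    (B := FiberBundle.extend E (B x)) hX' hx₃).pointwise (md _ hV₁ hx₁ hA') (md _ hU hx hA)
    (FiberBundle.extend_apply_self E (A x))
  have e2 := (curvatureOp_tensorial_left (cov := cov) hV₃
    (B := A) hX' hx₃).pointwise (md _ hV₂ hx₂ hB') (md _ hU hx hB)
    (FiberBundle.extend_apply_self E (B x))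
  beta_reduce at e1 e2
  rw [e1, curvatureOp_swap, e2, ← curvatureOp_swap]
  refine curvatureOp_eq_of_eq_at (hU.inter hV₃) (hA.mono inter_subset_left)
    (hB.mono inter_subset_left) (hX'.mono inter_subset_right) (hX.mono inter_subset_left)
    ⟨hx, hx₃⟩ (FiberBundle.extend_apply_self F (X x))

/-! ### Dual coframes and the rank of a family of subspaces -/

/-- Local sections that are linearly independent at `x` admit, near `x`, a dual system of
functionals on the fibres that maps smooth sections to smooth functions. The functionals are
`(L ∘ S)⁻¹ ∘ L`, where in a trivialization `S` maps coefficients to combinations of the sections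
and `L` is a left inverse of `S` at `x`. -/
theorem exists_dual_coframe [FiniteDimensional ℝ F] {d : ℕ} {U : Set M} (hU : IsOpen U)
    {s : Fin d → ∀ x, W x} (hs : ∀ j, CMDiff[U] ∞ (T% (s j))) {x : M} (hx : x ∈ U)
    (hli : LinearIndependent ℝ (fun j ↦ s j x)) :
    ∃ V ⊆ U, IsOpen V ∧ x ∈ V ∧ ∃ c : Fin d → ∀ z, W z →ₗ[ℝ] ℝ,
      (∀ z ∈ V, ∀ j k, c j z (s k z) = (Pi.single k 1 : Fin d → ℝ) j) ∧
      ∀ V' ⊆ V, IsOpen V' → ∀ X : ∀ x, W x, CMDiff[V'] ∞ (T% X) → ∀ j,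
        CMDiff[V'] ∞ (fun z ↦ c j z (X z)) := by
  classical
  let e := trivializationAt F W x
  have hxe : x ∈ e.baseSet := FiberBundle.mem_baseSet_trivializationAt F W x
  have happ : ∀ z ∈ e.baseSet, ∀ w : W z, e.linearMapAt ℝ z w = (e ⟨z, w⟩).2 := fun z hz w ↦ by
    rw [e.coe_linearMapAt_of_mem hz]
  let V₀ := U ∩ e.baseSet
  have hV₀ : IsOpen V₀ := hU.inter e.open_baseSet
  -- sections in the trivialization
  have hsec : ∀ V' ⊆ V₀, IsOpen V' → ∀ X : ∀ x, W x, CMDiff[V'] ∞ (T% X) →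
      CMDiff[V'] ∞ (fun z ↦ e.linearMapAt ℝ z (X z)) := fun V' hV' hV'o X hX ↦
    ((e.contMDiffOn_section_iff hV'o (hV'.trans inter_subset_right)).1 hX).congr
      fun z hz ↦ happ z (hV' hz).2 (X z)
  let S : M → (Fin d → ℝ) →L[ℝ] F := fun z ↦
    ∑ k, (ContinuousLinearMap.proj k).smulRight (e.linearMapAt ℝ z (s k z))
  have hS : ∀ z a, S z a = ∑ k, a k • e.linearMapAt ℝ z (s k z) := fun z a ↦ by
    simp [S]
  have hSinj : LinearMap.ker (S x : (Fin d → ℝ) →ₗ[ℝ] F) = ⊥ := by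
    rw [LinearMap.ker_eq_bot']
    intro a ha
    have h1 : e.linearMapAt ℝ x (∑ k, a k • s k x) = 0 := by
      rw [map_sum, ← ha]
      exact (Finset.sum_congr rfl fun k _ ↦ map_smul _ _ _).trans (hS x a).symm
    have h2 : ∑ k, a k • s k x = 0 :=
      (e.linearEquivAt ℝ x hxe).injective (by
        rw [map_zero]
        exact (happ x hxe _).symm.trans h1)
    exact funext (Fintype.linearIndependent_iff.1 hli a h2)
  obtain ⟨L₀, hL₀⟩ := LinearMap.exists_leftInverse_of_injective _ hSinj
  let L : F →L[ℝ] (Fin d → ℝ) := LinearMap.toContinuousLinearMap L₀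
  let T : M → (Fin d → ℝ) →L[ℝ] (Fin d → ℝ) := fun z ↦ L.comp (S z)
  have hTx : T x = 1 := by
    ext1 a
    exact LinearMap.congr_fun hL₀ a
  have hT : CMDiff[V₀] ∞ T := by
    have h1 : CMDiff[V₀] ∞ S := by
      refine contMDiffOn_finsetSum fun k _ ↦ ?_
      have h2 := hsec V₀ Subset.rfl hV₀ (s k) ((hs k).mono inter_subset_left)
      exact (ContinuousLinearMap.smulRightL ℝ (Fin d → ℝ) F
        (ContinuousLinearMap.proj k)).contMDiff.comp_contMDiffOn h2
    exact (ContinuousLinearMap.compL ℝ (Fin d → ℝ) F (Fin d → ℝ) L).contMDiff.comp_contMDiffOn h1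
  refine ⟨V₀ ∩ T ⁻¹' {A | IsUnit A}, fun z hz ↦ hz.1.1,
    hT.continuousOn.isOpen_inter_preimage hV₀ Units.isOpen, ⟨⟨hx, hxe⟩, by simp [hTx]⟩,
    fun j z ↦ LinearMap.proj j ∘ₗ
      ((Ring.inverse (T z) : (Fin d → ℝ) →L[ℝ] (Fin d → ℝ)) : (Fin d → ℝ) →ₗ[ℝ] (Fin d → ℝ))
        ∘ₗ L₀ ∘ₗ e.linearMapAt ℝ z, fun z hz j k ↦ ?_, fun V' hV' hV'o X hX j ↦ ?_⟩
  · have h1 : L₀ (e.linearMapAt ℝ z (s k z)) = T z (Pi.single k 1) := by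
      change _ = L₀ (S z _)
      rw [hS]
      simp [Pi.single_apply]
    have h2 : Ring.inverse (T z) (T z (Pi.single k 1)) = Pi.single k 1 :=
      DFunLike.congr_fun (Ring.inverse_mul_cancel (T z) hz.2) (Pi.single k 1)
    simp only [LinearMap.comp_apply, h1]
    exact congrFun h2 j
  · have h1 : CMDiff[V'] ∞ (fun z ↦ Ring.inverse (T z)) := fun z hz ↦ by
      obtain ⟨A, hA⟩ := (hV' hz).2
      have h2 : ContDiffAt ℝ ∞ Ring.inverse (T z) := by
        rw [← hA]
        exact contDiffAt_ringInverse ℝ A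
      exact h2.comp_contMDiffWithinAt ((hT z (hV' hz).1).mono fun y hy ↦ (hV' hy).1)
    have h3 := hsec V' (fun z hz ↦ (hV' hz).1) hV'o X hX
    have h4 := h1.clm_apply (L.contMDiff.comp_contMDiffOn h3)
    exact (ContinuousLinearMap.proj (R := ℝ) (φ := fun _ : Fin d ↦ ℝ) j).contMDiff.comp_contMDiffOn
      h4

section DualSystem

variable {A : Type*} [AddCommGroup A] [Module ℝ A] {d : ℕ} {s : Fin d → A}
  {c : Fin d → A →ₗ[ℝ] ℝ}

theorem linearIndependent_of_dual (h : ∀ j k, c j (s k) = (Pi.single k 1 : Fin d → ℝ) j) :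
    LinearIndependent ℝ s := by
  rw [Fintype.linearIndependent_iff]
  intro a ha j
  have := congrArg (c j) ha
  simpa [map_sum, h, Pi.single_apply] using this

theorem eq_sum_of_mem_span_of_dual (h : ∀ j k, c j (s k) = (Pi.single k 1 : Fin d → ℝ) j) {w : A}
    (hw : w ∈ Submodule.span ℝ (Set.range s)) : w = ∑ j, c j w • s j := by
  obtain ⟨a, rfl⟩ := (Submodule.mem_span_range_iff_exists_fun ℝ).1 hw
  simp [map_sum, h, Pi.single_apply]

end DualSystem

/-- The fibres of the family are linear subspaces. Families are given by subsets, as in the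
definition of the flag, and nothing is said about the dependence on the point. -/
def HasLinearFibres (V : ∀ x : M, Set (W x)) : Prop :=
  ∀ x, ∃ S : Submodule ℝ (W x), (S : Set (W x)) = V x

/-- The dimension of the fibre at `x`, or of its span if the fibre is not linear. -/
noncomputable def fibreRank (V : ∀ x : M, Set (W x)) (x : M) : ℕ :=
  Module.finrank ℝ (Submodule.span ℝ (V x))

theorem HasLinearFibres.coe_span {V : ∀ x : M, Set (W x)} (hV : HasLinearFibres V) (x : M) :
    (Submodule.span ℝ (V x) : Set (W x)) = V x := by
  obtain ⟨S, hS⟩ := hV x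
  rw [← hS, Submodule.span_eq]

theorem HasLinearFibres.mem_span_iff {V : ∀ x : M, Set (W x)} (hV : HasLinearFibres V) {x : M}
    {w : W x} : w ∈ Submodule.span ℝ (V x) ↔ w ∈ V x := by
  rw [← SetLike.mem_coe, hV.coe_span]

/-- A basis of the fibre at `x` extends to local sections with a dual coframe. The sections may be
chosen among those with a property `P` if every vector of the fibre is a value of one of these. -/
theorem HasLinearFibres.exists_sections_dual_coframe [FiniteDimensional ℝ F]
    {V : ∀ x : M, Set (W x)}
    (hV : HasLinearFibres V) {x : M} {P : (∀ x, W x) → Prop}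
    (h : ∀ w ∈ V x, ∃ (U : Set M) (X : ∀ x, W x), x ∈ U ∧ IsSmoothSectionOf E F V U X ∧ X x = w ∧
      P X) :
    ∃ O : Set M, IsOpen O ∧ x ∈ O ∧ ∃ (s : Fin (fibreRank V x) → ∀ x, W x)
      (c : Fin (fibreRank V x) → ∀ z, W z →ₗ[ℝ] ℝ),
      (∀ j, IsSmoothSectionOf E F V O (s j)) ∧ (∀ j, P (s j)) ∧
      (∀ z ∈ O, ∀ j k, c j z (s k z) = (Pi.single k 1 : Fin (fibreRank V x) → ℝ) j) ∧
      ∀ O' ⊆ O, IsOpen O' → ∀ X : ∀ x, W x, CMDiff[O'] ∞ (T% X) → ∀ j,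
        CMDiff[O'] ∞ (fun z ↦ c j z (X z)) := by
  have : FiniteDimensional ℝ (W x) := VectorBundle.finiteDimensional ℝ F W x
  let b := Module.finBasis ℝ (Submodule.span ℝ (V x))
  choose U X hxU hX hXx hP using fun j ↦ h (b j) (hV.mem_span_iff.1 (b j).2)
  have hO : IsOpen (⋂ j, U j) := isOpen_iInter_of_finite fun j ↦ (hX j).1
  have hli : LinearIndependent ℝ (fun j ↦ X j x) := by
    simp only [hXx]
    exact b.linearIndependent.map' (Submodule.subtype _) (Submodule.ker_subtype _)
  obtain ⟨O, hOU, hOo, hxO, c, hc, hc'⟩ := exists_dual_coframe hO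
    (fun j ↦ (hX j).2.1.mono (iInter_subset _ j)) (mem_iInter.2 hxU) hli
  exact ⟨O, hOo, hxO, X, c, fun j ↦ ⟨hOo, (hX j).2.1.mono (hOU.trans (iInter_subset _ j)),
    fun z hz ↦ (hX j).2.2 z (mem_iInter.1 (hOU hz) j)⟩, hP, hc, hc'⟩

/-- Linearly independent vectors of the fibre span it if there are enough of them. -/
theorem span_eq_of_fibreRank_le [FiniteDimensional ℝ F] {V : ∀ x : M, Set (W x)} {z : M} {d : ℕ}
    {s : Fin d → W z} (hs : ∀ j, s j ∈ V z) (hli : LinearIndependent ℝ s)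
    (hd : fibreRank V z ≤ d) :
    Submodule.span ℝ (Set.range s) = Submodule.span ℝ (V z) := by
  have : FiniteDimensional ℝ (W z) := VectorBundle.finiteDimensional ℝ F W z
  refine Submodule.eq_of_le_of_finrank_le
    (Submodule.span_mono (Set.range_subset_iff.2 hs)) ?_
  rw [finrank_span_eq_card hli, Fintype.card_fin]
  exact hd

/-- The rank is lower semicontinuous: smooth sections that are independent at a point stay
independent near it. -/
theorem HasLinearFibres.eventually_le_fibreRank [FiniteDimensional ℝ F] {V : ∀ x : M, Set (W x)}
    (hV : HasLinearFibres V) {x : M} (h : V x ⊆ smoothPart E F V x) :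
    ∀ᶠ z in 𝓝 x, fibreRank V x ≤ fibreRank V z := by
  obtain ⟨O, hO, hxO, s, c, hs, -, hc, -⟩ := hV.exists_sections_dual_coframe (E := E) (F := F)
    (x := x) (P := fun _ ↦ True) (fun w hw ↦ by
      obtain ⟨U, X, h1, h2, h3⟩ := h hw
      exact ⟨U, X, h1, h2, h3, trivial⟩)
  filter_upwards [hO.mem_nhds hxO] with z hz
  have : FiniteDimensional ℝ (W z) := VectorBundle.finiteDimensional ℝ F W z
  have hli := linearIndependent_of_dual (s := fun j ↦ s j z) (hc z hz)
  have h1 := finrank_span_eq_card hli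
  rw [Fintype.card_fin] at h1
  rw [← h1]
  exact Submodule.finrank_mono (Submodule.span_mono
    (Set.range_subset_iff.2 fun j ↦ (hs j).2.2 z hz))

/-- Where the rank is locally constant and the second fundamental form vanishes, its vanishing
does not depend on the choice of the section: `V` is spanned near `x` by sections whose derivatives
at `x` lie in `V`. -/
theorem HasLinearFibres.cov_mem_of_fibreRank_eq [FiniteDimensional ℝ F] {V : ∀ x : M, Set (W x)}
    (hV : HasLinearFibres V) {x : M} (h : V x ⊆ secondFundamentalKer cov V x)
    (hr : ∀ᶠ z in 𝓝 x, fibreRank V z = fibreRank V x) {U : Set M} {X : ∀ x, W x}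
    (hX : IsSmoothSectionOf E F V U X) (hxU : x ∈ U) (u : TangentSpace 𝓘(ℝ, E) x) :
    cov X x u ∈ V x := by
  obtain ⟨O, hO, hxO, s, c, hs, hP, hc, hc'⟩ := hV.exists_sections_dual_coframe (E := E) (F := F)
    (x := x) (P := fun Y ↦ ∀ u, cov Y x u ∈ V x) (fun w hw ↦ h hw)
  obtain ⟨N, hN, hNo, hxN⟩ := eventually_nhds_iff.1 hr
  let O' := O ∩ U ∩ N
  have hO' : IsOpen O' := (hO.inter hX.1).inter hNo
  have hxO' : x ∈ O' := ⟨⟨hxO, hxU⟩, hxN⟩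
  have hcX := hc' O' (fun z hz ↦ hz.1.1) hO' X (hX.2.1.mono fun z hz ↦ hz.1.2)
  have hs' : ∀ j, CMDiff[O'] ∞ (T% (s j)) := fun j ↦ (hs j).2.1.mono fun z hz ↦ hz.1.1
  -- the rank being constant, the sections `s j` form a frame near `x`
  have hsum : ∀ z ∈ O', X z = ∑ j, ((fun z ↦ c j z (X z)) • s j) z := fun z hz ↦ by
    refine eq_sum_of_mem_span_of_dual (c := fun j ↦ c j z) (s := fun j ↦ s j z) (hc z hz.1.1) ?_
    rw [span_eq_of_fibreRank_le (F := F) (V := V) (fun j ↦ (hs j).2.2 z hz.1.1)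
      (linearIndependent_of_dual (hc z hz.1.1)) (hN z hz.2).le]
    exact Submodule.subset_span (hX.2.2 z hz.1.2)
  have hsm : ∀ j ∈ Finset.univ, CMDiff[O'] ∞ (T% ((fun z ↦ c j z (X z)) • s j)) :=
    fun j _ ↦ (hcX j).smul_section (hs' j)
  rw [cov_congr cov hO' (.sum_section hsm) hsum hxO', cov_sum hO' hsm hxO',
    sum_apply, ← hV.mem_span_iff]
  refine Submodule.sum_mem _ fun j _ ↦ ?_
  rw [cov_smul hO' (hcX j) (hs' j) hxO']
  exact Submodule.add_mem _ (Submodule.smul_mem _ _ (Submodule.subset_span (hP j u)))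
    (Submodule.smul_mem _ _ (Submodule.subset_span ((hs j).2.2 x hxO)))

/-! ### The members of the derived flag -/

theorem smoothPart_subset (V : ∀ x : M, Set (W x)) (x : M) : smoothPart E F V x ⊆ V x := by
  rintro w ⟨U, X, hx, hX, rfl⟩
  exact hX.2.2 x hx

theorem secondFundamentalKer_subset (V : ∀ x : M, Set (W x)) (x : M) :
    secondFundamentalKer cov V x ⊆ V x := by
  rintro w ⟨U, X, hx, hX, rfl, -⟩
  exact hX.2.2 x hx

/-- A smooth section of `V` is a smooth section of the smooth part of `V`. -/
theorem IsSmoothSectionOf.smoothPart {V : ∀ x : M, Set (W x)} {U : Set M} {X : ∀ x, W x}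
    (hX : IsSmoothSectionOf E F V U X) : IsSmoothSectionOf E F (smoothPart E F V) U X :=
  ⟨hX.1, hX.2.1, fun _ hy ↦ ⟨U, X, hy, hX, rfl⟩⟩

theorem smoothPart_smoothPart (V : ∀ x : M, Set (W x)) (x : M) :
    smoothPart E F V x ⊆ smoothPart E F (smoothPart E F V) x := by
  rintro w ⟨U, X, hx, hX, rfl⟩
  exact ⟨U, X, hx, hX.smoothPart, rfl⟩

theorem flag_succ_subset (i : ℕ) (x : M) : flag cov (i + 1) x ⊆ flag cov i x :=
  (smoothPart_subset _ x).trans (secondFundamentalKer_subset _ x)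

theorem flag_antitone (x : M) : Antitone fun i ↦ flag cov i x :=
  antitone_nat_of_succ_le fun i ↦ flag_succ_subset i x

/-- Every vector of a member of the flag is the value of a smooth section of this member. -/
theorem flag_subset_smoothPart (i : ℕ) (x : M) :
    flag cov i x ⊆ smoothPart E F (flag cov i) x := by
  cases i with
  | zero => exact smoothPart_smoothPart _ x
  | succ i => exact smoothPart_smoothPart _ x

theorem hasLinearFibres_of {V : ∀ x : M, Set (W x)} (h0 : ∀ x, 0 ∈ V x)
    (hadd : ∀ x, ∀ v ∈ V x, ∀ w ∈ V x, v + w ∈ V x)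
    (hsmul : ∀ x, ∀ (a : ℝ), ∀ v ∈ V x, a • v ∈ V x) : HasLinearFibres V := fun x ↦
  ⟨{ carrier := V x
     add_mem' := fun {v w} hv hw ↦ hadd x v hv w hw
     zero_mem' := h0 x
     smul_mem' := fun a v hv ↦ hsmul x a v hv }, rfl⟩

theorem HasLinearFibres.zero_mem {V : ∀ x : M, Set (W x)} (hV : HasLinearFibres V) (x : M) :
    0 ∈ V x := hV.mem_span_iff.1 (Submodule.zero_mem _)

theorem HasLinearFibres.add_mem {V : ∀ x : M, Set (W x)} (hV : HasLinearFibres V) {x : M}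
    {v w : W x} (hv : v ∈ V x) (hw : w ∈ V x) : v + w ∈ V x :=
  hV.mem_span_iff.1 (Submodule.add_mem _ (hV.mem_span_iff.2 hv) (hV.mem_span_iff.2 hw))

theorem HasLinearFibres.smul_mem {V : ∀ x : M, Set (W x)} (hV : HasLinearFibres V) {x : M}
    (a : ℝ) {v : W x} (hv : v ∈ V x) : a • v ∈ V x :=
  hV.mem_span_iff.1 (Submodule.smul_mem _ a (hV.mem_span_iff.2 hv))

theorem HasLinearFibres.zero_section {V : ∀ x : M, Set (W x)} (hV : HasLinearFibres V) :
    IsSmoothSectionOf E F V univ (fun _ ↦ 0) :=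
  ⟨isOpen_univ, (contMDiff_zeroSection ℝ W).contMDiffOn, fun y _ ↦ hV.zero_mem y⟩

theorem HasLinearFibres.add_section {V : ∀ x : M, Set (W x)} (hV : HasLinearFibres V)
    {U U' : Set M} {X Y : ∀ x, W x} (hX : IsSmoothSectionOf E F V U X)
    (hY : IsSmoothSectionOf E F V U' Y) : IsSmoothSectionOf E F V (U ∩ U') (X + Y) :=
  ⟨hX.1.inter hY.1, (hX.2.1.mono inter_subset_left).add_section (hY.2.1.mono inter_subset_right),
    fun y hy ↦ hV.add_mem (hX.2.2 y hy.1) (hY.2.2 y hy.2)⟩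

theorem HasLinearFibres.smul_section {V : ∀ x : M, Set (W x)} (hV : HasLinearFibres V)
    {U : Set M} {X : ∀ x, W x} (hX : IsSmoothSectionOf E F V U X) (a : ℝ) :
    IsSmoothSectionOf E F V U ((fun _ : M ↦ a) • X) :=
  ⟨hX.1, contMDiffOn_const.smul_section hX.2.1, fun y hy ↦ hV.smul_mem a (hX.2.2 y hy)⟩

theorem HasLinearFibres.smoothPart {V : ∀ x : M, Set (W x)} (hV : HasLinearFibres V) :
    HasLinearFibres (smoothPart E F V) := by
  refine hasLinearFibres_of (fun x ↦ ⟨univ, _, mem_univ x, hV.zero_section, rfl⟩) ?_ ?_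
  · rintro x _ ⟨U, X, hx, hX, rfl⟩ _ ⟨U', Y, hx', hY, rfl⟩
    exact ⟨U ∩ U', X + Y, ⟨hx, hx'⟩, hV.add_section hX hY, rfl⟩
  · rintro x a _ ⟨U, X, hx, hX, rfl⟩
    exact ⟨U, _, hx, hV.smul_section hX a, rfl⟩

theorem HasLinearFibres.secondFundamentalKer {V : ∀ x : M, Set (W x)} (hV : HasLinearFibres V) :
    HasLinearFibres (secondFundamentalKer cov V) := by
  refine hasLinearFibres_of (fun x ↦ ⟨univ, _, mem_univ x, hV.zero_section, rfl, fun u ↦ ?_⟩) ?_ ?_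
  · have h : cov (fun _ ↦ 0) x = 0 := congrFun cov.zero x
    rw [h]
    exact hV.zero_mem x
  · rintro x _ ⟨U, X, hx, hX, rfl, hX'⟩ _ ⟨U', Y, hx', hY, rfl, hY'⟩
    refine ⟨U ∩ U', X + Y, ⟨hx, hx'⟩, hV.add_section hX hY, rfl, fun u ↦ ?_⟩
    rw [cov_add (hX.1.inter hY.1) (hX.2.1.mono inter_subset_left)
      (hY.2.1.mono inter_subset_right) ⟨hx, hx'⟩]
    exact hV.add_mem (hX' u) (hY' u)
  · rintro x a _ ⟨U, X, hx, hX, rfl, hX'⟩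
    refine ⟨U, _, hx, hV.smul_section hX a, rfl, fun u ↦ ?_⟩
    rw [cov_smul hX.1 contMDiffOn_const hX.2.1 hx]
    rw [mvfderiv_const, zero_apply, zero_smul, add_zero]
    exact hV.smul_mem a (hX' u)

section

variable [T2Space M] [FiniteDimensional ℝ E] [FiniteDimensional ℝ F]
  [CovariantDerivative.ContMDiffCovariantDerivative cov ∞]

theorem exists_isOpen_extend_tangent_smooth {x : M} (u v : TangentSpace 𝓘(ℝ, E) x) :
    ∃ V : Set M, IsOpen V ∧ x ∈ V ∧ CMDiff[V] ∞ (T% (FiberBundle.extend E u)) ∧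
      CMDiff[V] ∞ (T% (FiberBundle.extend E v)) := by
  obtain ⟨V₁, hV₁, hx₁, h₁⟩ := exists_isOpen_extend_smooth (E := E) (F := E) (W := fun x : M ↦
    TangentSpace 𝓘(ℝ, E) x) u
  obtain ⟨V₂, hV₂, hx₂, h₂⟩ := exists_isOpen_extend_smooth (E := E) (F := E) (W := fun x : M ↦
    TangentSpace 𝓘(ℝ, E) x) v
  exact ⟨V₁ ∩ V₂, hV₁.inter hV₂, ⟨hx₁, hx₂⟩, h₁.mono inter_subset_left, h₂.mono inter_subset_right⟩

/-- The curvature on a section, where the fields may stay the extensions of the definition. -/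
theorem curvature_apply_section {U : Set M} (hU : IsOpen U) {X : ∀ x, W x}
    (hX : CMDiff[U] ∞ (T% X)) {x : M} (hx : x ∈ U) (u v : TangentSpace 𝓘(ℝ, E) x) :
    curvature cov x u v (X x) =
      curvatureOp cov (FiberBundle.extend E u) (FiberBundle.extend E v) X x := by
  obtain ⟨V, hV, hxV, hu, hv⟩ := exists_isOpen_extend_tangent_smooth u v
  have h := curvature_eq_curvatureOp (cov := cov) (hU.inter hV) (hu.mono inter_subset_right)
    (hv.mono inter_subset_right) (hX.mono inter_subset_left) ⟨hx, hxV⟩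
  rwa [FiberBundle.extend_apply_self, FiberBundle.extend_apply_self] at h

theorem hasLinearFibres_curvatureKer : HasLinearFibres (curvatureKer cov) := by
  refine hasLinearFibres_of (fun x u v ↦ ?_) (fun x w₁ h₁ w₂ h₂ u v ↦ ?_) (fun x a w hw u v ↦ ?_)
  · have h := curvature_apply_section (cov := cov) isOpen_univ
      (contMDiff_zeroSection ℝ W).contMDiffOn (mem_univ x) u v
    have h0 : cov (fun _ ↦ 0) = 0 := cov.zero
    refine h.trans ?_
    simp only [curvatureOp, h0, Pi.zero_apply, zero_apply, sub_zero]
  · obtain ⟨V, hV, hxV, hu, hv⟩ := exists_isOpen_extend_tangent_smooth u v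
    obtain ⟨V₁, hV₁, hx₁, hw₁⟩ := exists_isOpen_extend_smooth (E := E) (F := F) w₁
    obtain ⟨V₂, hV₂, hx₂, hw₂⟩ := exists_isOpen_extend_smooth (E := E) (F := F) w₂
    have hO := hV.inter (hV₁.inter hV₂)
    have h1 := hw₁.mono fun z (hz : z ∈ V ∩ (V₁ ∩ V₂)) ↦ hz.2.1
    have h2 := hw₂.mono fun z (hz : z ∈ V ∩ (V₁ ∩ V₂)) ↦ hz.2.2
    have h := curvature_apply_section (cov := cov) hO (h1.add_section h2) ⟨hxV, hx₁, hx₂⟩ u v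
    rw [curvatureOp_add hO (hu.mono inter_subset_left) (hv.mono inter_subset_left) h1 h2
      ⟨hxV, hx₁, hx₂⟩] at h
    simp only [Pi.add_apply, FiberBundle.extend_apply_self] at h
    rw [h]
    exact (congrArg₂ _ (h₁ u v) (h₂ u v)).trans (add_zero 0)
  · obtain ⟨V, hV, hxV, hu, hv⟩ := exists_isOpen_extend_tangent_smooth u v
    obtain ⟨V₁, hV₁, hx₁, hw₁⟩ := exists_isOpen_extend_smooth (E := E) (F := F) w
    have hO := hV.inter hV₁
    have h1 := hw₁.mono fun z (hz : z ∈ V ∩ V₁) ↦ hz.2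
    have h := curvature_apply_section (cov := cov) hO
      ((contMDiffOn_const (c := a)).smul_section h1) ⟨hxV, hx₁⟩ u v
    rw [curvatureOp_smul hO (hu.mono inter_subset_left) (hv.mono inter_subset_left)
      contMDiffOn_const h1 ⟨hxV, hx₁⟩] at h
    simp only [Pi.smul_apply', FiberBundle.extend_apply_self] at h
    rw [h]
    exact (congrArg (a • ·) (hw u v)).trans (smul_zero a)

theorem hasLinearFibres_flag (i : ℕ) : HasLinearFibres (flag cov i) := by
  induction i with
  | zero => exact hasLinearFibres_curvatureKer.smoothPart
  | succ i ih => exact ih.secondFundamentalKer.smoothPart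

/-- Parallel sections take values in all members of the flag. -/
theorem IsParallelOn.mem_flag {U : Set M} {X : ∀ x, W x} (hX : IsParallelOn cov U X) (i : ℕ) :
    ∀ y ∈ U, X y ∈ flag cov i y := by
  obtain ⟨⟨hU, hXs, -⟩, hpar⟩ := hX
  induction i with
  | zero =>
    refine fun y hy ↦ ⟨U, X, hy, ⟨hU, hXs, fun z hz u v ↦ ?_⟩, rfl⟩
    rw [curvature_apply_section hU hXs hz]
    have h : ∀ A : ∀ x : M, TangentSpace 𝓘(ℝ, E) x, cov (fun y ↦ cov X y (A y)) z = 0 := fun A ↦ by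
      rw [cov_congr cov hU (contMDiff_zeroSection ℝ W).contMDiffOn
        (fun y hy ↦ by rw [hpar y hy]; rfl) hz]
      exact congrFun cov.zero z
    simp only [curvatureOp, h, hpar z hz, zero_apply, sub_zero]
  | succ i ih =>
    refine fun y hy ↦ ⟨U, X, hy, ⟨hU, hXs, fun z hz ↦ ⟨U, X, hz, ⟨hU, hXs, ih⟩, rfl, fun u ↦ ?_⟩⟩,
      rfl⟩
    rw [hpar z hz]
    exact (hasLinearFibres_flag i).zero_mem z

/-- The kernel of the curvature is closed: a smooth section that lies in it over a dense set lies
in it everywhere. -/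
theorem mem_curvatureKer_of_dense {O U : Set M} (hO : Dense O) (hU : IsOpen U) {X : ∀ x, W x}
    (hX : CMDiff[U] ∞ (T% X)) (h : ∀ z ∈ U ∩ O, X z ∈ curvatureKer cov z) :
    ∀ z ∈ U, X z ∈ curvatureKer cov z := by
  intro y hy u v
  obtain ⟨V, hV, hyV, hu, hv⟩ := exists_isOpen_extend_tangent_smooth u v
  rw [curvature_apply_section hU hX hy]
  set A := FiberBundle.extend E u
  set B := FiberBundle.extend E v
  let e := trivializationAt F W y
  let N := (U ∩ V) ∩ e.baseSet
  have hN : IsOpen N := (hU.inter hV).inter e.open_baseSet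
  have hyN : y ∈ N := ⟨⟨hy, hyV⟩, FiberBundle.mem_baseSet_trivializationAt F W y⟩
  have hX' := hX.mono fun z (hz : z ∈ N) ↦ hz.1.1
  have hA := hu.mono fun z (hz : z ∈ N) ↦ hz.1.2
  have hB := hv.mono fun z (hz : z ∈ N) ↦ hz.1.2
  have hs : CMDiff[N] ∞ (T% (curvatureOp cov A B X)) :=
    ((covApply_smooth cov hN (covApply_smooth cov hN hX' hB) hA).sub_section
      (covApply_smooth cov hN (covApply_smooth cov hN hX' hA) hB)).sub_section
        (covApply_smooth cov hN hX' (mlieBracket_smooth hN hA hB))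
  have hc : ContinuousOn (fun z ↦ (e ⟨z, curvatureOp cov A B X z⟩).2) N :=
    ((e.contMDiffOn_section_iff hN inter_subset_right).1 hs).continuousOn
  have hz : ∀ z ∈ N ∩ O, (e ⟨z, curvatureOp cov A B X z⟩).2 = 0 := by
    intro z hz
    have h1 : curvatureOp cov A B X z = 0 := by
      rw [← curvature_eq_curvatureOp hN hA hB hX' hz.1]
      exact h z ⟨hz.1.1.1, hz.2⟩ _ _
    rw [h1]
    exact (e.linearEquivAt ℝ z hz.1.2).map_zero
  have h0 : (e ⟨y, curvatureOp cov A B X y⟩).2 = 0 :=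
    ((hc y hyN).mono inter_subset_left).eq_const_of_mem_closure
      (hO.open_subset_closure_inter hN hyN) hz
  exact (e.linearEquivAt ℝ y hyN.2).map_eq_zero_iff.1 h0

theorem secondFundamentalKer_mono_of_isOpen {V V' : ∀ x : M, Set (W x)} {N : Set M}
    (hN : IsOpen N) (h : ∀ z ∈ N, V z ⊆ V' z) {x : M} (hx : x ∈ N) :
    secondFundamentalKer cov V x ⊆ secondFundamentalKer cov V' x := by
  rintro w ⟨U, X, hxU, hX, rfl, hX'⟩
  exact ⟨U ∩ N, X, ⟨hxU, hx⟩, ⟨hX.1.inter hN, hX.2.1.mono inter_subset_left,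
    fun z hz ↦ h z hz.2 (hX.2.2 z hz.1)⟩, rfl, fun u ↦ h x hx (hX' u)⟩

theorem smoothPart_mono_of_isOpen {V V' : ∀ x : M, Set (W x)} {N : Set M}
    (hN : IsOpen N) (h : ∀ z ∈ N, V z ⊆ V' z) {x : M} (hx : x ∈ N) :
    smoothPart E F V x ⊆ smoothPart E F V' x := by
  rintro w ⟨U, X, hxU, hX, rfl⟩
  exact ⟨U ∩ N, X, ⟨hxU, hx⟩, ⟨hX.1.inter hN, hX.2.1.mono inter_subset_left,
    fun z hz ↦ h z hz.2 (hX.2.2 z hz.1)⟩, rfl⟩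

/-! ### Stationarity of the derived flag -/

/-- If the flag is stationary at one step over an open set, it is so from then on. -/
theorem flag_subset_succ_of_le {N : Set M} (hN : IsOpen N) {i j : ℕ} (hij : i ≤ j)
    (h : ∀ z ∈ N, flag cov i z ⊆ flag cov (i + 1) z) :
    ∀ z ∈ N, flag cov j z ⊆ flag cov (j + 1) z := by
  induction j, hij using Nat.le_induction with
  | base => exact h
  | succ j _ ih =>
    exact fun z hz ↦ smoothPart_mono_of_isOpen hN
      (fun y hy ↦ secondFundamentalKer_mono_of_isOpen hN ih hy) hz

/-- Finitely many bounded lower semicontinuous functions with values in the natural numbers are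
locally constant on a dense open set. -/
theorem exists_dense_locally_constant {X ι : Type*} [TopologicalSpace X] [Fintype ι]
    {f : ι → X → ℕ} {C : ℕ} (hC : ∀ i x, f i x ≤ C)
    (hf : ∀ i x, ∀ᶠ z in 𝓝 x, f i x ≤ f i z) :
    ∃ O : Set X, IsOpen O ∧ Dense O ∧ ∀ x ∈ O, ∀ i, ∀ᶠ z in 𝓝 x, f i z = f i x := by
  refine ⟨{x | ∀ i, ∀ᶠ z in 𝓝 x, f i z = f i x}, ?_, ?_, fun x hx ↦ hx⟩
  · refine isOpen_iff_mem_nhds.2 fun x hx ↦ ?_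
    filter_upwards [(eventually_all.2 hx).eventually_nhds] with z hz i
    filter_upwards [hz] with y hy
    rw [hy i, hz.self_of_nhds i]
  · refine dense_iff_inter_open.2 fun U hU ⟨x₀, hx₀⟩ ↦ ?_
    -- all functions are constant near a point of `U` where their sum is maximal
    have hb : BddAbove ((fun x ↦ ∑ i, f i x) '' U) :=
      ⟨∑ _i : ι, C, by rintro _ ⟨x, -, rfl⟩; exact Finset.sum_le_sum fun i _ ↦ hC i x⟩
    obtain ⟨x, hxU, hx⟩ := Nat.sSup_mem ⟨_, mem_image_of_mem _ hx₀⟩ hb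
    refine ⟨x, hxU, ?_⟩
    have h : ∀ᶠ z in 𝓝 x, ∀ i, f i z = f i x := by
      filter_upwards [eventually_all.2 fun i ↦ hf i x, hU.mem_nhds hxU] with z hz hzU i
      have h1 : ∑ i, f i z ≤ ∑ i, f i x := (le_csSup hb (mem_image_of_mem _ hzU)).trans hx.ge
      have h2 := (Finset.sum_eq_sum_iff_of_le fun i _ ↦ hz i).1
        (le_antisymm (Finset.sum_le_sum fun i _ ↦ hz i) h1)
      exact (h2 i (Finset.mem_univ i)).symm
    exact eventually_all.1 h

theorem fibreRank_le (V : ∀ x : M, Set (W x)) (x : M) :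
    fibreRank V x ≤ Module.finrank ℝ F := by
  have : FiniteDimensional ℝ (W x) := VectorBundle.finiteDimensional ℝ F W x
  refine (Submodule.finrank_le _).trans_eq ?_
  exact ((trivializationAt F W x).linearEquivAt ℝ x
    (FiberBundle.mem_baseSet_trivializationAt F W x)).finrank_eq

/-- On a dense open set the flag is stationary from the step `finrank ℝ F` on, and the second
fundamental form of that member vanishes on all its sections: where the ranks of the first members
are locally constant, two consecutive ones have the same rank, hence coincide. -/
theorem exists_dense_cov_mem_flag : ∃ O : Set M, IsOpen O ∧ Dense O ∧ ∀ x ∈ O,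
    ∀ (U : Set M) (X : ∀ x, W x), x ∈ U →
      IsSmoothSectionOf E F (flag cov (Module.finrank ℝ F)) U X →
      ∀ u, cov X x u ∈ flag cov (Module.finrank ℝ F) x := by
  set n := Module.finrank ℝ F with hn
  obtain ⟨O, hO, hOd, h⟩ := exists_dense_locally_constant
    (f := fun (i : Fin (n + 2)) (x : M) ↦ fibreRank (flag cov i) x) (fun i x ↦ fibreRank_le (F := F) _ x)
    (fun i x ↦ (hasLinearFibres_flag (cov := cov) i).eventually_le_fibreRank
      (flag_subset_smoothPart _ x))
  replace h : ∀ x ∈ O, ∀ i < n + 2, ∀ᶠ z in 𝓝 x,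
      fibreRank (flag cov i) z = fibreRank (flag cov i) x := fun x hx i hi ↦ h x hx ⟨i, hi⟩
  refine ⟨O, hO, hOd, fun x hx U X hxU hX u ↦ ?_⟩
  -- the `n + 2` ranks lie between `0` and `n`, so they do not decrease at every step
  obtain ⟨i, hi, hri⟩ : ∃ i ≤ n, fibreRank (flag cov i) x ≤ fibreRank (flag cov (i + 1)) x := by
    by_contra! hcon
    have : ∀ i ≤ n + 1, fibreRank (flag cov i) x + i ≤ n := fun i ↦ by
      induction i with
      | zero => exact fun _ ↦ fibreRank_le (F := F) _ x
      | succ i ih =>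
        intro hi
        have h1 := ih (by lia)
        have h2 := hcon i (by lia)
        lia
    have := this (n + 1) le_rfl
    lia
  obtain ⟨N, hN, hNo, hxN⟩ := eventually_nhds_iff.1
    ((h x hx i (by lia)).and (h x hx (i + 1) (by lia)))
  have hst : ∀ z ∈ N, flag cov i z ⊆ flag cov (i + 1) z := fun z hz ↦ by
    have : FiniteDimensional ℝ (W z) := VectorBundle.finiteDimensional ℝ F W z
    have h1 : Submodule.span ℝ (flag cov (i + 1) z) = Submodule.span ℝ (flag cov i z) := by
      refine Submodule.eq_of_le_of_finrank_le (Submodule.span_mono (flag_succ_subset i z)) ?_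
      change fibreRank (flag cov i) z ≤ fibreRank (flag cov (i + 1)) z
      rw [(hN z hz).1, (hN z hz).2]
      exact hri
    rw [← (hasLinearFibres_flag (cov := cov) (i + 1)).coe_span, h1]
    exact Submodule.subset_span
  exact (hasLinearFibres_flag n).cov_mem_of_fibreRank_eq
    ((flag_subset_succ_of_le hNo hi hst x hxN).trans (smoothPart_subset _ x)) (h x hx n (by lia))
    hX hxU u

/-- The derived flag is stationary from the step `finrank ℝ F` on. A section of this member lies
in the kernel of the curvature over a dense set together with all its iterated derivatives, hence
everywhere. -/
theorem flag_finrank_subset (i : ℕ) (x : M) :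
    flag cov (Module.finrank ℝ F) x ⊆ flag cov i x := by
  obtain ⟨O, hO, hOd, h⟩ := exists_dense_cov_mem_flag (cov := cov)
  -- `h` applies to `X` over `U ∩ O`, so the hypothesis passes from `X` to its derivatives
  have key : ∀ (U : Set M) (X : ∀ x, W x), IsOpen U → CMDiff[U] ∞ (T% X) →
      (∀ z ∈ U ∩ O, X z ∈ flag cov (Module.finrank ℝ F) z) → ∀ z ∈ U, X z ∈ flag cov i z := by
    induction i with
    | zero =>
      refine fun U X hU hX hXO z hz ↦ ⟨U, X, hz, ⟨hU, hX, mem_curvatureKer_of_dense hOd hU hX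
        fun y hy ↦ ?_⟩, rfl⟩
      exact smoothPart_subset _ y (flag_antitone y (Nat.zero_le _) (hXO y hy))
    | succ i ih =>
      refine fun U X hU hX hXO z hz ↦ ⟨U, X, hz, ⟨hU, hX, fun y hy ↦
        ⟨U, X, hy, ⟨hU, hX, ih U X hU hX hXO⟩, rfl, fun u ↦ ?_⟩⟩, rfl⟩
      obtain ⟨V, hV, hyV, hu, -⟩ := exists_isOpen_extend_tangent_smooth u u
      have h1 := ih (U ∩ V) (fun y ↦ cov X y (FiberBundle.extend E u y)) (hU.inter hV)
        (covApply_smooth cov (hU.inter hV) (hX.mono inter_subset_left) (hu.mono inter_subset_right))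
        (fun t ht ↦ h t ht.2 (U ∩ O) X ⟨ht.1.1, ht.2⟩
          ⟨hU.inter hO, hX.mono inter_subset_left, hXO⟩ _) y ⟨hy, hyV⟩
      rwa [FiberBundle.extend_apply_self] at h1
  intro w hw
  obtain ⟨U, X, hxU, hX, rfl⟩ := flag_subset_smoothPart _ x hw
  exact key U X hX.1 hX.2.1 (fun z hz ↦ hX.2.2 z hz.1) x hxU

theorem flag_eq_flagLimit {l : ℕ} (hl : Module.finrank ℝ F ≤ l) :
    flag cov l = flagLimit cov := by
  funext x
  exact subset_antisymm (subset_iInter fun i ↦ (flag_antitone x hl).trans (flag_finrank_subset i x))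
    (iInter_subset _ l)

end

/-! ### Coordinate fields -/

section ChartFields

variable [FiniteDimensional ℝ E]

/-- The coordinate field of the chart at `x` in the constant direction `a`. Outside the source of
the chart its values carry no meaning, but it is linear in `a` everywhere. -/
noncomputable def chartField (x : M) (a : E) : ∀ y : M, TangentSpace 𝓘(ℝ, E) y :=
  VectorField.mpullback 𝓘(ℝ, E) 𝓘(ℝ, E) (extChartAt 𝓘(ℝ, E) x) (fun _ ↦ a)

theorem chartField_add (x : M) (a b : E) (y : M) :
    chartField x (a + b) y = chartField x a y + chartField x b y :=
  map_add (mfderiv 𝓘(ℝ, E) 𝓘(ℝ, E) (extChartAt 𝓘(ℝ, E) x) y).inverse a b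

theorem chartField_smul (x : M) (r : ℝ) (a : E) (y : M) :
    chartField x (r • a) y = r • chartField x a y :=
  map_smul (mfderiv 𝓘(ℝ, E) 𝓘(ℝ, E) (extChartAt 𝓘(ℝ, E) x) y).inverse r a

theorem isInvertible_mfderiv_chart {x y : M} (hy : y ∈ (extChartAt 𝓘(ℝ, E) x).source) :
    (mfderiv 𝓘(ℝ, E) 𝓘(ℝ, E) (extChartAt 𝓘(ℝ, E) x) y).IsInvertible := by
  have : IsManifold 𝓘(ℝ, E) 1 M := .of_le (n := ∞) (by simp)
  exact isInvertible_mfderiv_extChartAt hy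

theorem mfderiv_chartField {x y : M} (hy : y ∈ (extChartAt 𝓘(ℝ, E) x).source) (a : E) :
    mfderiv 𝓘(ℝ, E) 𝓘(ℝ, E) (extChartAt 𝓘(ℝ, E) x) y (chartField x a y) = a := by
  obtain ⟨e, he⟩ := isInvertible_mfderiv_chart hy
  change mfderiv 𝓘(ℝ, E) 𝓘(ℝ, E) (extChartAt 𝓘(ℝ, E) x) y
    ((mfderiv 𝓘(ℝ, E) 𝓘(ℝ, E) (extChartAt 𝓘(ℝ, E) x) y).inverse a) = a
  rw [← he, ContinuousLinearMap.inverse_equiv]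
  exact e.apply_symm_apply a

theorem chartField_mfderiv {x y : M} (hy : y ∈ (extChartAt 𝓘(ℝ, E) x).source)
    (u : TangentSpace 𝓘(ℝ, E) y) :
    chartField (E := E) x (mfderiv 𝓘(ℝ, E) 𝓘(ℝ, E) (extChartAt 𝓘(ℝ, E) x) y u) y = u := by
  obtain ⟨e, he⟩ := isInvertible_mfderiv_chart hy
  change (mfderiv 𝓘(ℝ, E) 𝓘(ℝ, E) (extChartAt 𝓘(ℝ, E) x) y).inverse _ = u
  rw [← he, ContinuousLinearMap.inverse_equiv]
  exact e.symm_apply_apply u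

theorem smooth_extChartAt (x : M) :
    CMDiff[(extChartAt 𝓘(ℝ, E) x).source] ∞ (extChartAt 𝓘(ℝ, E) x) := by
  rw [extChartAt_source]
  exact contMDiffOn_extChartAt

theorem smooth_chartField (x : M) (a : E) :
    CMDiff[(extChartAt 𝓘(ℝ, E) x).source] ∞ (T% (chartField x a)) := fun y hy ↦ by
  have : CompleteSpace E := FiniteDimensional.complete ℝ E
  refine ContMDiffAt.contMDiffWithinAt ?_
  refine ContMDiffAt.mpullback_vectorField_preimage (n := ∞) ?_
    ((smooth_extChartAt x).contMDiffAt ((isOpen_extChartAt_source x).mem_nhds hy))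
    (isInvertible_mfderiv_chart hy) (by simp)
  exact contMDiffAt_vectorSpace_iff_contDiffAt.2 contDiffAt_const

/-- The chain rule for a function read in the chart. -/
theorem mvfderiv_comp_extChartAt {x y : M} (hy : y ∈ (extChartAt 𝓘(ℝ, E) x).source) {g : E → ℝ}
    {g' : E →L[ℝ] ℝ} (hg : HasFDerivAt g g' (extChartAt 𝓘(ℝ, E) x y))
    (u : TangentSpace 𝓘(ℝ, E) y) :
    d% (fun z ↦ g (extChartAt 𝓘(ℝ, E) x z)) y u =
      g' (mfderiv 𝓘(ℝ, E) 𝓘(ℝ, E) (extChartAt 𝓘(ℝ, E) x) y u) := by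
  have hφ : MDiffAt (extChartAt 𝓘(ℝ, E) x) y :=
    ((smooth_extChartAt x).contMDiffAt
      ((isOpen_extChartAt_source x).mem_nhds hy)).mdifferentiableAt (by simp)
  have h := (hg.hasMFDerivAt.comp y hφ.hasMFDerivAt).mfderiv
  exact congrArg (fun T ↦ T u) h

/-- Coordinate fields commute, as they correspond to constant fields in the chart. -/
theorem mlieBracket_chartField {x y : M} (hy : y ∈ (extChartAt 𝓘(ℝ, E) x).source) (a b : E) :
    VectorField.mlieBracket 𝓘(ℝ, E) (chartField x a) (chartField x b) y = 0 := by
  have : CompleteSpace E := FiniteDimensional.complete ℝ E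
  have : IsManifold 𝓘(ℝ, E) (minSmoothness ℝ 3) M := by
    simp only [minSmoothness_of_isRCLikeNormedField]; infer_instance
  have hc : ∀ a : E, MDifferentiableAt 𝓘(ℝ, E) 𝓘(ℝ, E).tangent
      (fun z : E ↦ (⟨z, a⟩ : TangentBundle 𝓘(ℝ, E) E)) (extChartAt 𝓘(ℝ, E) x y) := fun a ↦
    (contMDiffAt_vectorSpace_iff_contDiffAt (n := 1).2 contDiffAt_const).mdifferentiableAt (by simp)
  have h := VectorField.mpullback_mlieBracket (I := 𝓘(ℝ, E)) (n := ∞) (hc a) (hc b)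
    ((smooth_extChartAt x).contMDiffAt ((isOpen_extChartAt_source x).mem_nhds hy)) (by
      simpa using WithTop.coe_le_coe.2 (le_top : (2 : ℕ∞) ≤ ⊤))
  have h0 : VectorField.lieBracketWithin ℝ (fun _ : E ↦ a) (fun _ ↦ b) univ = 0 := by
    funext z
    simp [VectorField.lieBracketWithin]
  have h1 := VectorField.mlieBracketWithin_eq_lieBracketWithin (𝕜 := ℝ) (E := E) (s := univ)
    (V := fun _ ↦ a) (W := fun _ ↦ b)
  refine h.symm.trans ?_
  exact (congrArg (mfderiv 𝓘(ℝ, E) 𝓘(ℝ, E) (extChartAt 𝓘(ℝ, E) x) y).inverse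
    (congrFun (VectorField.mlieBracketWithin_univ.symm.trans (h1.trans h0)) _)).trans (map_zero _)

end ChartFields

/-! ### Parallel sections of a flat subbundle -/

section

variable [T2Space M] [FiniteDimensional ℝ E] [FiniteDimensional ℝ F]
  [CovariantDerivative.ContMDiffCovariantDerivative cov ∞]

/-- The derivative of a combination of the sections of a frame, in terms of the dual coframe. -/
theorem dual_cov_sum {d : ℕ} {U : Set M} (hU : IsOpen U) {s : Fin d → ∀ x, W x}
    (hs : ∀ j, CMDiff[U] ∞ (T% (s j))) {c : Fin d → ∀ z, W z →ₗ[ℝ] ℝ}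
    (hc : ∀ z ∈ U, ∀ j k, c j z (s k z) = (Pi.single k 1 : Fin d → ℝ) j)
    {f : Fin d → M → ℝ} (hf : ∀ j, CMDiff[U] ∞ (f j)) {z : M} (hz : z ∈ U)
    (u : TangentSpace 𝓘(ℝ, E) z) (i : Fin d) :
    c i z (cov (fun y ↦ ∑ k, (f k • s k) y) z u) =
      ∑ k, c i z (cov (s k) z u) * f k z + d% (f i) z u := by
  rw [cov_sum hU (fun k _ ↦ (hf k).smul_section (hs k)) hz, sum_apply, map_sum]
  simp only [cov_smul hU (hf _) (hs _) hz, map_add, map_smul, hc z hz, smul_eq_mul,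
    Finset.sum_add_distrib, Pi.single_apply, mul_ite, mul_one, mul_zero, Finset.sum_ite_eq,
    Finset.mem_univ, if_true]
  exact congrArg (· + _) (Finset.sum_congr rfl fun k _ ↦ mul_comm _ _)

/-- The structure equations: for a frame of a subbundle that is preserved by the connection and
contained in the kernel of the curvature, the connection matrices in coordinate directions
satisfy the flatness condition. -/
theorem connection_matrix_flat {x : M} {d : ℕ} {U : Set M} (hU : IsOpen U)
    (hUx : U ⊆ (extChartAt 𝓘(ℝ, E) x).source) {s : Fin d → ∀ x, W x}
    (hs : ∀ j, CMDiff[U] ∞ (T% (s j))) {c : Fin d → ∀ z, W z →ₗ[ℝ] ℝ}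
    (hc : ∀ z ∈ U, ∀ j k, c j z (s k z) = (Pi.single k 1 : Fin d → ℝ) j)
    (hspan : ∀ z ∈ U, ∀ j u, cov (s j) z u ∈ Submodule.span ℝ (range fun k ↦ s k z))
    (hR : ∀ z ∈ U, ∀ j, s j z ∈ curvatureKer cov z)
    (hθ : ∀ a i j, CMDiff[U] ∞ (fun z ↦ c i z (cov (s j) z (chartField x a z))))
    {z : M} (hz : z ∈ U) (a b : E) (i j : Fin d) :
    d% (fun z ↦ c i z (cov (s j) z (chartField x b z))) z (chartField x a z) -
      d% (fun z ↦ c i z (cov (s j) z (chartField x a z))) z (chartField x b z) +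
      ∑ k, c i z (cov (s k) z (chartField x a z)) * c k z (cov (s j) z (chartField x b z)) -
      ∑ k, c i z (cov (s k) z (chartField x b z)) * c k z (cov (s j) z (chartField x a z)) = 0 := by
  have hA : ∀ a : E, CMDiff[U] ∞ (T% (chartField x a)) := fun a ↦ (smooth_chartField x a).mono hUx
  have key : ∀ a b : E, c i z (cov (fun y ↦ cov (s j) y (chartField x b y)) z (chartField x a z)) =
      ∑ k, c i z (cov (s k) z (chartField x a z)) * c k z (cov (s j) z (chartField x b z)) +
        d% (fun z ↦ c i z (cov (s j) z (chartField x b z))) z (chartField x a z) := fun a b ↦ by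
    rw [← dual_cov_sum (cov := cov) hU hs hc (fun k ↦ hθ b k j) hz]
    refine congrArg (fun T : TangentSpace 𝓘(ℝ, E) z →L[ℝ] W z ↦ c i z (T (chartField x a z))) ?_
    exact (cov_congr cov hU (covApply_smooth cov hU (hs j) (hA b)) (fun y hy ↦
      (eq_sum_of_mem_span_of_dual (c := fun k ↦ c k y) (hc y hy) (hspan y hy j _)).symm) hz).symm
  have h := curvature_eq_curvatureOp (cov := cov) hU (hA a) (hA b) (hs j) hz
  rw [hR z hz j, curvatureOp, mlieBracket_chartField (hUx hz), map_zero, sub_zero] at h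
  have h' := congrArg (c i z) h
  rw [map_zero, map_sub, key, key] at h'
  linarith

/-- The derivative in the chart is the derivative along coordinate fields. -/
theorem fderiv_comp_extChartAt_symm {x z : M} {U : Set M} (hU : IsOpen U)
    (hUx : U ⊆ (extChartAt 𝓘(ℝ, E) x).source) (hz : z ∈ U) {f : M → ℝ} {g : E → ℝ}
    {g' : E →L[ℝ] ℝ} (hg : HasFDerivAt g g' (extChartAt 𝓘(ℝ, E) x z))
    (hgf : ∀ p, g p = f ((extChartAt 𝓘(ℝ, E) x).symm p)) (a : E) :
    g' a = d% f z (chartField x a z) := by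
  have h := mvfderiv_comp_extChartAt (hUx hz) hg (chartField x a z)
  rw [mfderiv_chartField (hUx hz)] at h
  rw [← h]
  have he : (fun y ↦ g (extChartAt 𝓘(ℝ, E) x y)) =ᶠ[𝓝 z] f := by
    filter_upwards [hU.mem_nhds hz] with y hy
    rw [hgf, (extChartAt 𝓘(ℝ, E) x).left_inv (hUx hy)]
  exact congrArg (fun T : TangentSpace 𝓘(ℝ, E) z →L[ℝ] ℝ ↦ T (chartField x a z)) he.mfderiv_eq

/-- A frame of a subbundle that is preserved by the connection and contained in the kernel of the
curvature has a parallel combination with given coefficients at a point: in the chart, the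
coefficients solve `dc = -Γ c` for the connection form `Γ` of the frame, which is flat. -/
theorem exists_parallel_combination {x : M} {d : ℕ} {U : Set M} (hU : IsOpen U) (hxU : x ∈ U)
    (hUx : U ⊆ (extChartAt 𝓘(ℝ, E) x).source) {s : Fin d → ∀ x, W x}
    (hs : ∀ j, CMDiff[U] ∞ (T% (s j))) {c : Fin d → ∀ z, W z →ₗ[ℝ] ℝ}
    (hc : ∀ z ∈ U, ∀ j k, c j z (s k z) = (Pi.single k 1 : Fin d → ℝ) j)
    (hc' : ∀ X : ∀ x, W x, CMDiff[U] ∞ (T% X) → ∀ j, CMDiff[U] ∞ (fun z ↦ c j z (X z)))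
    (hspan : ∀ z ∈ U, ∀ j u, cov (s j) z u ∈ Submodule.span ℝ (range fun k ↦ s k z))
    (hR : ∀ z ∈ U, ∀ j, s j z ∈ curvatureKer cov z) (v : Fin d → ℝ) :
    ∃ U' ⊆ U, IsOpen U' ∧ x ∈ U' ∧ ∃ f : Fin d → M → ℝ, (∀ j, f j x = v j) ∧
      (∀ j, CMDiff[U'] ∞ (f j)) ∧ ∀ z ∈ U', cov (fun y ↦ ∑ k, (f k • s k) y) z = 0 := by
  classical
  let φ := extChartAt 𝓘(ℝ, E) x
  have hφ : CMDiff[φ.source] ∞ φ := smooth_extChartAt x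
  have hψ : CMDiff[φ.target] ∞ φ.symm := contMDiffOn_extChartAt_symm x
  have hψc : ContinuousOn φ.symm φ.target := continuousOn_extChartAt_symm x
  have hθ : ∀ (a : E) i j, CMDiff[U] ∞ (fun z ↦ c i z (cov (s j) z (chartField x a z))) :=
    fun a i j ↦ hc' _ (covApply_smooth cov hU (hs j) ((smooth_chartField x a).mono hUx)) i
  -- the connection form in the chart, with values in the endomorphisms of the coefficient space
  let θ : M → E →ₗ[ℝ] Matrix (Fin d) (Fin d) ℝ := fun z ↦
    { toFun := fun a ↦ Matrix.of fun i j ↦ c i z (cov (s j) z (chartField x a z))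
      map_add' := fun a b ↦ by ext i j; simp [chartField_add]
      map_smul' := fun r a ↦ by ext i j; simp [chartField_smul] }
  let Γ : E → E →L[ℝ] (Fin d → ℝ) →L[ℝ] (Fin d → ℝ) := fun p ↦ LinearMap.toContinuousLinearMap
    ((LinearMap.toContinuousLinearMap (𝕜 := ℝ) (E := Fin d → ℝ) (F' := Fin d → ℝ)).toLinearMap ∘ₗ
      (Matrix.toLin' (R := ℝ) (m := Fin d) (n := Fin d)).toLinearMap ∘ₗ θ (φ.symm p))
  have hΓ : ∀ p a w i, Γ p a w i =
      ∑ j, c i (φ.symm p) (cov (s j) (φ.symm p) (chartField x a (φ.symm p))) * w j :=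
    fun p a w i ↦ rfl
  have hΓ1 : ∀ p a i j, Γ p a (Pi.single j 1) i =
      c i (φ.symm p) (cov (s j) (φ.symm p) (chartField x a (φ.symm p))) := fun p a i j ↦ by
    rw [hΓ]
    simp [Pi.single_apply]
  let Ω := φ.target ∩ φ.symm ⁻¹' U
  have hΩ : IsOpen Ω := hψc.isOpen_inter_preimage (isOpen_extChartAt_target x) hU
  have hΓs : ContDiffOn ℝ ∞ Γ Ω := by
    refine contDiffOn_clm_apply.2 fun a ↦ contDiffOn_clm_apply.2 fun w ↦ contDiffOn_pi.2 fun i ↦ ?_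
    simp only [hΓ]
    refine ContDiffOn.sum fun j _ ↦ ContDiffOn.mul ?_ contDiffOn_const
    exact contMDiffOn_iff_contDiffOn.1 ((hθ a i j).comp (hψ.mono inter_subset_left) fun p hp ↦ hp.2)
  have flat : ∀ p ∈ Ω, ∀ a b, fderiv ℝ Γ p a b - fderiv ℝ Γ p b a + (Γ p a).comp (Γ p b)
      - (Γ p b).comp (Γ p a) = 0 := by
    intro p hp a b
    have hd : HasFDerivAt Γ (fderiv ℝ Γ p) p :=
      ((hΓs.contDiffAt (hΩ.mem_nhds hp)).differentiableAt (by simp)).hasFDerivAt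
    have hpz : φ (φ.symm p) = p := φ.right_inv hp.1
    have hder : ∀ a b i j, fderiv ℝ Γ p a b (Pi.single j 1) i =
        d% (fun z ↦ c i z (cov (s j) z (chartField x b z))) (φ.symm p)
          (chartField x a (φ.symm p)) := fun a b i j ↦ by
      let ℓ : (E →L[ℝ] (Fin d → ℝ) →L[ℝ] (Fin d → ℝ)) →L[ℝ] ℝ :=
        (ContinuousLinearMap.proj i).comp ((ContinuousLinearMap.apply ℝ (Fin d → ℝ)
          (Pi.single j 1 : Fin d → ℝ)).comp
            (ContinuousLinearMap.apply ℝ ((Fin d → ℝ) →L[ℝ] (Fin d → ℝ)) b))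
      have h1 : HasFDerivAt (fun q ↦ Γ q b (Pi.single j 1) i) (ℓ.comp (fderiv ℝ Γ p))
          (φ (φ.symm p)) := by
        rw [hpz]
        exact ℓ.hasFDerivAt.comp p hd
      exact fderiv_comp_extChartAt_symm hU hUx hp.2 h1
        (f := fun z ↦ c i z (cov (s j) z (chartField x b z))) (fun q ↦ hΓ1 q b i j) a
    refine ContinuousLinearMap.coe_injective ((Pi.basisFun ℝ (Fin d)).ext fun j ↦ ?_)
    funext i
    have h := connection_matrix_flat (cov := cov) hU hUx hs hc hspan hR hθ hp.2 a b i j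
    rw [← hder, ← hder] at h
    simp only [Pi.basisFun_apply, ContinuousLinearMap.coe_coe, sub_apply, add_apply,
      ContinuousLinearMap.comp_apply, Pi.sub_apply, Pi.add_apply, zero_apply, Pi.zero_apply]
    rw [hΓ p a (Γ p b _), hΓ p b (Γ p a _)]
    simp only [hΓ1]
    exact h
  have hx : φ x ∈ Ω := ⟨φ.map_source (hUx hxU), by
    rw [mem_preimage, φ.left_inv (hUx hxU)]; exact hxU⟩
  obtain ⟨N, hNΩ, hN, hxN, f, hfx, hf, hfd⟩ := exists_smooth_solution_of_flat hΩ hΓs flat hx v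
  let U' := U ∩ (φ.source ∩ φ ⁻¹' N)
  have hU' : IsOpen U' := hU.inter
    (hφ.continuousOn.isOpen_inter_preimage (isOpen_extChartAt_source x) hN)
  have hfs : ∀ j, CMDiff[U'] ∞ (fun z ↦ f (φ z) j) := fun j ↦
    (contMDiffOn_iff_contDiffOn.2 ((contDiffOn_pi.1 hf) j)).comp
      (hφ.mono fun z (hz : z ∈ U') ↦ hz.2.1) fun z hz ↦ hz.2.2
  refine ⟨U', inter_subset_left, hU', ⟨hxU, hUx hxU, hxN⟩, fun j z ↦ f (φ z) j,
    fun j ↦ congrFun hfx j, hfs, fun z hz ↦ ?_⟩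
  have hs' : ∀ j, CMDiff[U'] ∞ (T% (s j)) := fun j ↦ (hs j).mono inter_subset_left
  have hc0 : ∀ y ∈ U', ∀ j k, c j y (s k y) = (Pi.single k 1 : Fin d → ℝ) j :=
    fun y hy ↦ hc y hy.1
  -- the derivative lies in the span of the frame, so it suffices that its coefficients vanish
  ext u
  have hmem : cov (fun y ↦ ∑ k, ((fun z ↦ f (φ z) k) • s k) y) z u ∈
      Submodule.span ℝ (range fun k ↦ s k z) := by
    rw [cov_sum hU' (fun k _ ↦ (hfs k).smul_section (hs' k)) hz, sum_apply]
    refine Submodule.sum_mem _ fun k _ ↦ ?_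
    rw [cov_smul hU' (hfs k) (hs' k) hz]
    exact Submodule.add_mem _ (Submodule.smul_mem _ _ (hspan z hz.1 k u))
      (Submodule.smul_mem _ _ (Submodule.subset_span ⟨k, rfl⟩))
  rw [eq_sum_of_mem_span_of_dual (c := fun k ↦ c k z) (hc z hz.1) hmem]
  refine Finset.sum_eq_zero fun i _ ↦ ?_
  rw [dual_cov_sum hU' hs' hc0 hfs hz]
  obtain ⟨a, rfl, h1⟩ : ∃ a : E, chartField x a z = u ∧
      d% (fun y ↦ f (φ y) i) z u = -Γ (φ z) a (f (φ z)) i :=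
    ⟨mfderiv 𝓘(ℝ, E) 𝓘(ℝ, E) φ z u, chartField_mfderiv (hUx hz.1) u,
      mvfderiv_comp_extChartAt (g := fun p ↦ f p i) (hUx hz.1)
        (hasFDerivAt_pi'.1 (hfd (φ z) hz.2.2) i) u⟩
  rw [h1, hΓ, φ.left_inv hz.2.1, add_neg_cancel, zero_smul]

/-- Parallel sections through the limit of the flag at points where it is a bundle. -/
theorem IsRegularAt.exists_parallel {x : M} (hx : IsRegularAt cov x) {w : W x}
    (hw : w ∈ flagLimit cov x) :
    ∃ (U : Set M) (X : ∀ x, W x), x ∈ U ∧ IsParallelOn cov U X ∧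
      (∀ y ∈ U, X y ∈ flagLimit cov y) ∧ X x = w := by
  obtain ⟨U₀, -, hxU₀, h⟩ := hx
  obtain ⟨U₁, -, hU₁, hxU₁, d, s, hs, hsV⟩ := h x hxU₀
  obtain ⟨V, hVU, hV, hxV, c, hc, hc'⟩ := exists_dual_coframe hU₁ (fun j ↦ (hs j).2.1) hxU₁
    (hsV x hxU₁).1
  have hflag := flag_eq_flagLimit (cov := cov) le_rfl
  have hlin : HasLinearFibres (flagLimit cov) := by
    rw [← hflag]
    exact hasLinearFibres_flag _
  have hker : ∀ z, flagLimit cov z ⊆ secondFundamentalKer cov (flagLimit cov) z := fun z ↦ by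
    have h1 := smoothPart_subset (E := E) (F := F)
      (secondFundamentalKer cov (flag cov (Module.finrank ℝ F))) z
    change flag cov (Module.finrank ℝ F + 1) z ⊆ _ at h1
    rwa [flag_eq_flagLimit (Nat.le_succ _), hflag] at h1
  have hrank : ∀ z ∈ U₁, fibreRank (flagLimit cov) z = d := fun z hz ↦ by
    rw [fibreRank, (hsV z hz).2, Submodule.span_span, finrank_span_eq_card (hsV z hz).1,
      Fintype.card_fin]
  have hcov : ∀ z ∈ U₁, ∀ j u, cov (s j) z u ∈ Submodule.span ℝ (range fun k ↦ s k z) :=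
    fun z hz j u ↦ by
      have h1 := hlin.cov_mem_of_fibreRank_eq (hker z) (by
        filter_upwards [hU₁.mem_nhds hz] with y hy
        rw [hrank y hy, hrank z hz]) (hs j) hz u
      rwa [(hsV z hz).2] at h1
  let U := V ∩ (extChartAt 𝓘(ℝ, E) x).source
  have hU : IsOpen U := hV.inter (isOpen_extChartAt_source x)
  obtain ⟨U', hU'U, hU', hxU', f, hfx, hf, hpar⟩ := exists_parallel_combination (cov := cov) hU
    ⟨hxV, mem_extChartAt_source x⟩ inter_subset_right
    (fun j ↦ (hs j).2.1.mono fun z hz ↦ hVU hz.1) (fun z hz ↦ hc z hz.1)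
    (hc' U inter_subset_left hU) (fun z hz ↦ hcov z (hVU hz.1))
    (fun z hz j ↦ smoothPart_subset _ z (mem_iInter.1 ((hs j).2.2 z (hVU hz.1)) 0))
    (fun j ↦ c j x w)
  have hsm : CMDiff[U'] ∞ (T% (fun y ↦ ∑ k, (f k • s k) y)) :=
    .sum_section fun k _ ↦ (hf k).smul_section ((hs k).2.1.mono fun z hz ↦ hVU (hU'U hz).1)
  refine ⟨U', fun y ↦ ∑ k, (f k • s k) y, hxU', ⟨⟨hU', hsm, fun _ _ ↦ trivial⟩, hpar⟩,
    fun y hy ↦ ?_, ?_⟩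
  · rw [(hsV y (hVU (hU'U hy).1)).2]
    exact Submodule.sum_mem _ fun k _ ↦ Submodule.smul_mem _ _ (Submodule.subset_span ⟨k, rfl⟩)
  · rw [(hsV x hxU₁).2] at hw
    refine Eq.trans ?_ (eq_sum_of_mem_span_of_dual (c := fun k ↦ c k x) (hc x hxV) hw).symm
    exact Finset.sum_congr rfl fun k _ ↦ by
      change f k x • s k x = _
      rw [hfx]

end

end Connections

end DerivedFlag

theorem theorem1
    {E : Type*} [NormedAddCommGroup E] [NormedSpace ℝ E] [FiniteDimensional ℝ E]
    {M : Type*} [TopologicalSpace M] [T2Space M] [ChartedSpace E M] [IsManifold 𝓘(ℝ, E) ∞ M]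
    {F : Type*} [NormedAddCommGroup F] [NormedSpace ℝ F] [FiniteDimensional ℝ F]
    {W : M → Type*} [TopologicalSpace (TotalSpace F W)]
    [∀ x, AddCommGroup (W x)] [∀ x, Module ℝ (W x)] [∀ x, TopologicalSpace (W x)]
    [∀ x, IsTopologicalAddGroup (W x)] [∀ x, ContinuousSMul ℝ (W x)]
    [FiberBundle F W] [VectorBundle ℝ F W] [ContMDiffVectorBundle ∞ F W 𝓘(ℝ, E)]
    (cov : CovariantDerivative 𝓘(ℝ, E) F W) [CovariantDerivative.ContMDiffCovariantDerivative cov ∞] :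
    -- the derived flag decreases and becomes stationary
    ((∀ i x, DerivedFlag.flag cov (i + 1) x ⊆ DerivedFlag.flag cov i x) ∧
      ∃ k, ∀ l ≥ k, DerivedFlag.flag cov l = DerivedFlag.flagLimit cov) ∧
    -- (i)
    (∀ (U : Set M) (X : ∀ x, W x), DerivedFlag.IsParallelOn cov U X →
      ∀ y ∈ U, X y ∈ DerivedFlag.flagLimit cov y) ∧
    -- (ii)
    (∀ x : M, DerivedFlag.IsRegularAt cov x → ∀ w ∈ DerivedFlag.flagLimit cov x,
      ∃ (U : Set M) (X : ∀ x, W x), x ∈ U ∧ DerivedFlag.IsParallelOn cov U X ∧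
        (∀ y ∈ U, X y ∈ DerivedFlag.flagLimit cov y) ∧ X x = w) := by
  refine ⟨⟨DerivedFlag.flag_succ_subset, Module.finrank ℝ F, fun l hl ↦
    DerivedFlag.flag_eq_flagLimit hl⟩, fun U X hX y hy ↦ Set.mem_iInter.2 fun i ↦
      hX.mem_flag i y hy, fun x hx w hw ↦ hx.exists_parallel hw⟩
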